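/- A variable is a pair of integers $(l,r)$ with $1\le l\le r$. A branch and bound tree is a binary tree, with a variable assigned to each inner node, in which every inner node has exactly one left and one right child; its size is its number of nodes (inner nodes and leaves). The gap closed at the root is $0$; branching on $(l,r)$ at a node where the gap closed is $g$, the gap closed is $g+l$ at its left child and $g+r$ at its right child. The tree closes the gap $G$ if the gap closed at each leaf is at least $G$. The problem Single Variable Branching is: given integers $l,r,G,k$ in binary with $1\le l\le r\le G$ and $k\ge 1$, is the size of the minimal tree that closes $G$ and branches on $(l,r)$ at every inner node at most $k$? Theorem. Single Variable Branching is in P. Furthermore, for all integers $1\le l\le r$ and $G\ge 1$, there is a unique tree of minimal size among the trees that close $G$ and branch only on $(l,r)$, and its size is $$ t(G)=1+2\sum_{k_r=1}^{\lceil G/r\rceil}\binom{k_r+\left\lceil\frac{G-(k_r-1)r}{l}\right\rceil-1}{k_r}. $$ Let $d=\lceil G/r\rceil$. If $t(G)\le k$ then $k\ge 2^{d+1}-1$ (so the answer is NO if $k<2^{d+1}-1$). There is a single program that, on input $(l,r,G)$, evaluates the formula in $O(d^2)$ operations (additions, subtractions, multiplications, integer divisions, assignments and comparisons of integers, each counted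 as one operation); for every $k\ge 2^{d+1}-1$ this is $O(\log^2 k)$. The implied constants are absolute. -/

import Mathlib

/-! ### Abstract branch and bound trees -/

namespace BranchBound

/-- A branching variable: a pair of integer gains `1 ≤ l ≤ r`. -/
structure BranchVar where
  /-- the left gain -/
  l : ℕ
  /-- the right gain -/
  r : ℕ
  l_pos : 1 ≤ l
  l_le_r : l ≤ r

/-- A branch and bound tree: a binary tree whose inner nodes (each having exactly a left and a
right child) carry the variable branched on. -/
inductive BBTree : Type
  | leaf : BBTree
  | node (x : BranchVar) (left right : BBTree) : BBTree

namespace BBTree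

/-- The number of nodes (inner nodes and leaves). -/
def size : BBTree → ℕ
  | leaf => 1
  | node _ left right => 1 + left.size + right.size

/-- The set of variables branched on in the tree. -/
def vars : BBTree → Set BranchVar
  | leaf => ∅
  | node x left right => {x} ∪ left.vars ∪ right.vars

/-- The dual gaps closed at the leaves, when the gap closed at the root is `g`: branching on `x`
adds `x.l` at the left child and `x.r` at the right child. -/
def leafGaps : BBTree → ℕ → List ℕ
  | leaf, g => [g]
  | node x left right, g => left.leafGaps (g + x.l) ++ right.leafGaps (g + x.r)

/-- The tree closes the gap `G` if the gap closed at each leaf is at least `G`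
(the gap closed at the root being `0`). -/
def Closes (T : BBTree) (G : ℕ) : Prop := ∀ g ∈ T.leafGaps 0, G ≤ g

/-- `T` branches on no variable other than `x`, closes the gap `G`, and has the least number of
nodes among all such trees. -/
def IsMinimalFor (T : BBTree) (x : BranchVar) (G : ℕ) : Prop :=
  (T.vars ⊆ {x} ∧ T.Closes G) ∧
    ∀ T' : BBTree, T'.vars ⊆ {x} → T'.Closes G → T.size ≤ T'.size

end BBTree

/-- The question of Single Variable Branching: does the (minimal) tree closing the gap `G` and
using only the variable `x` have at most `k` nodes? -/
def SVBYes (x : BranchVar) (G k : ℕ) : Prop :=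
  ∃ T : BBTree, T.IsMinimalFor x G ∧ T.size ≤ k

/-- The depth `d = ⌈G / r⌉`. -/
def depth (x : BranchVar) (G : ℕ) : ℕ := ⌈(G : ℚ) / x.r⌉₊

/-- The closed formula
`1 + 2 * ∑_{k=1}^{⌈G/r⌉} C(k + ⌈(G - (k-1) r) / l⌉ - 1, k)`. For `k` in the range of summation
one has `G - (k-1) r > 0` and `k ≥ 1`, so neither `⌈·⌉₊` nor the subtraction truncates. -/
def closedForm (x : BranchVar) (G : ℕ) : ℕ :=
  1 + 2 * ∑ k ∈ Finset.Icc 1 ⌈(G : ℚ) / x.r⌉₊,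
    Nat.choose (k + ⌈((G : ℚ) - ((k : ℚ) - 1) * x.r) / x.l⌉₊ - 1) k

/-! ### The complexity class P and the language of the problem -/

open Classical in
/-- The class P: the membership function of the language `L` is computed in time polynomial in
the length of the word by a (multi-stack) Turing machine. -/
def InP {Γ : Type} (L : Language Γ) : Prop :=
  Nonempty (Turing.TM2ComputableInPolyTime (id : List Γ → List Γ) Computability.encodeBool
    (fun w : List Γ => decide (w ∈ L)))

/-- The binary digits of `n` as a word over the alphabet `{some false, some true, none}`;
`none` is the separator. -/
def bits (n : ℕ) : List (Option Bool) := (Computability.encodeNat n).map some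

/-- The encoding of an instance: four binary numbers, separated by `none`. -/
def encodeInstance (l r G k : ℕ) : List (Option Bool) :=
  bits l ++ none :: bits r ++ none :: bits G ++ none :: bits k

/-- The language of (encodings of) YES-instances of Single Variable Branching: the input is
`(l, r)`, `G`, `k` with `1 ≤ l ≤ r ≤ G` and `k ≥ 1`. -/
def svbLanguage : Language (Option Bool) :=
  {w | ∃ (x : BranchVar) (G k : ℕ), x.r ≤ G ∧ 1 ≤ k ∧ SVBYes x G k ∧
    w = encodeInstance x.l x.r G k}

/-! ### Programs over the integers, counting operations -/

/-- The four arithmetic operations on integers. -/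
inductive ArithOp : Type
  | add | sub | mul | div

/-- Evaluation; `div` is integer division (rounding down when the divisor is positive). -/
def ArithOp.eval : ArithOp → ℤ → ℤ → ℤ
  | add, a, b => a + b
  | sub, a, b => a - b
  | mul, a, b => a * b
  | div, a, b => a / b

/-- Programs with integer registers indexed by `ℕ` (each program mentions finitely many). -/
inductive Prog : Type
  /-- `i := c` -/
  | const (i : ℕ) (c : ℤ) : Prog
  /-- `i := j ∘ k` for an arithmetic operation `∘` -/
  | op (o : ArithOp) (i j k : ℕ) : Prog
  /-- `p; q` -/
  | seq (p q : Prog) : Prog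
  /-- `if i > 0 then p else q` -/
  | ite (i : ℕ) (p q : Prog) : Prog
  /-- `while i > 0 do p` -/
  | loop (i : ℕ) (p : Prog) : Prog

/-- `Exec p s s' n`: started with register contents `s`, the program `p` halts with register
contents `s'` after exactly `n` operations. Every assignment, every arithmetic operation and every
comparison counts as one operation. -/
inductive Exec : Prog → (ℕ → ℤ) → (ℕ → ℤ) → ℕ → Prop
  | const (i : ℕ) (c : ℤ) (s : ℕ → ℤ) :
      Exec (.const i c) s (Function.update s i c) 1
  | op (o : ArithOp) (i j k : ℕ) (s : ℕ → ℤ) :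
      Exec (.op o i j k) s (Function.update s i (o.eval (s j) (s k))) 1
  | seq {p q : Prog} {s s' s'' : ℕ → ℤ} {m n : ℕ} :
      Exec p s s' m → Exec q s' s'' n → Exec (.seq p q) s s'' (m + n)
  | ite_pos {i : ℕ} {p q : Prog} {s s' : ℕ → ℤ} {n : ℕ} :
      0 < s i → Exec p s s' n → Exec (.ite i p q) s s' (n + 1)
  | ite_neg {i : ℕ} {p q : Prog} {s s' : ℕ → ℤ} {n : ℕ} :
      s i ≤ 0 → Exec q s s' n → Exec (.ite i p q) s s' (n + 1)
  | loop_pos {i : ℕ} {p : Prog} {s s' s'' : ℕ → ℤ} {m n : ℕ} :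
      0 < s i → Exec p s s' m → Exec (.loop i p) s' s'' n →
        Exec (.loop i p) s s'' (m + n + 1)
  | loop_neg {i : ℕ} {p : Prog} {s : ℕ → ℤ} :
      s i ≤ 0 → Exec (.loop i p) s s 1

/-- The initial register contents: `l`, `r`, `G` in the registers `0`, `1`, `2`, and `0` in all
others. -/
def inputRegs (x : BranchVar) (G : ℕ) : ℕ → ℤ
  | 0 => x.l
  | 1 => x.r
  | 2 => G
  | _ => 0

end BranchBound

/-! Minimal tree. If a positive gap `G` remains at a node, the tree has to branch there, and its two
subtrees have to close `G - l` and `G - r`, with subtraction truncated at zero. If nothing remains,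
branching only adds nodes. Hence the tree that branches exactly as long as necessary is the unique
minimum (`minTree_least`), and its size satisfies `t(0) = 1` and `t(G) = 1 + t(G - l) + t(G - r)`
for `G > 0`.

Formula. An inner node reached by `k` right and `j` left branches exists when `k r + j l < G`, and
there are `C(k + j, k)` such paths. Summing over `j` gives `C(k + ⌈(G - k r)/l⌉, k + 1)` inner nodes
with `k` right branches, and a binary tree with `n` inner nodes has `1 + 2n` nodes. The proof checks
that this expression satisfies the recurrence for `t`, by Pascal's rule (`levelCount_succ`).

Lower bound and operation count. Since `t` is monotone and `l ≤ r`, `t(G) ≥ 1 + 2 t(G - r)`, and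
passing from `G` to `G - r` lowers `d` by one, so `t(G) ≥ 2^(d+1) - 1`. The `k`-th binomial
coefficient takes `k` multiplications and exact divisions, which gives `O(d²)` operations; `2^d ≤ k`
turns this into `O(log² k)`.

Membership in P. On a word of length `L`, the deciding program compares powers of two with `k` while
it subtracts `r` from `G`. After at most `L` rounds either `k` is known to be too small or `d ≤ L`,
and then every value in the evaluation is at most `2^((L+2)²)` (`bounded_decideValid`). The program
is carried to a multi-stack Turing machine in two stages. Integer operations become additions and
truncated subtractions of naturals, with multiplication and division by repeated doubling
(`Prog.Bounded.exec_cmd`). These become serial arithmetic on stacks of bits (`run_code`). Each stage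
costs a factor polynomial in the number of bits, hence in `L`. -/

namespace BranchBound

/-! ### Ceiling division -/

/-- Ceiling division on the natural numbers. -/
def cdiv (a b : ℕ) : ℕ := (a + (b - 1)) / b

/-- This adjunction characterizes ceiling division; identities of ceilings follow by comparing upper
bounds. -/
lemma cdiv_le_iff {a b n : ℕ} (hb : 0 < b) : cdiv a b ≤ n ↔ a ≤ n * b := by
  rw [cdiv, Nat.div_le_iff_le_mul_add_pred hb, mul_comm]
  omega

lemma ceil_cast_div (a : ℕ) {b : ℕ} (hb : 0 < b) : ⌈(a : ℚ) / b⌉₊ = cdiv a b := by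
  refine eq_of_forall_ge_iff fun n => ?_
  rw [Nat.ceil_le, cdiv_le_iff hb, div_le_iff₀ (by exact_mod_cast hb)]
  exact_mod_cast Iff.rfl

@[simp] lemma cdiv_zero (b : ℕ) : cdiv 0 b = 0 := by
  rcases Nat.eq_zero_or_pos b with rfl | hb
  · simp [cdiv]
  · exact Nat.le_zero.1 ((cdiv_le_iff hb).2 (by simp))

lemma cdiv_eq_succ {a b : ℕ} (hb : 0 < b) (ha : 0 < a) : cdiv a b = cdiv (a - b) b + 1 := by
  refine eq_of_forall_ge_iff fun n => ?_
  rw [cdiv_le_iff hb]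
  rcases n with - | n
  · simp; omega
  · rw [Nat.add_le_add_iff_right, cdiv_le_iff hb, Nat.succ_mul]
    omega

lemma cdiv_pos {a b : ℕ} (hb : 0 < b) (ha : 0 < a) : 0 < cdiv a b := by
  rw [cdiv_eq_succ hb ha]; omega

lemma cdiv_le_self {a b : ℕ} (hb : 0 < b) : cdiv a b ≤ a :=
  (cdiv_le_iff hb).2 (Nat.le_mul_of_pos_right a hb)

lemma depth_eq (x : BranchVar) (G : ℕ) : depth x G = cdiv G x.r :=
  ceil_cast_div G (x.l_pos.trans x.l_le_r)

/-! ### The closed form counts inner nodes -/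

/-- The summand of the closed formula for index `k + 1`. -/
def levelCount (l r G k : ℕ) : ℕ := Nat.choose (k + cdiv (G - k * r) l) (k + 1)

lemma levelCount_eq_zero {l r G k : ℕ} (h : G ≤ k * r) : levelCount l r G k = 0 := by
  simp [levelCount, Nat.sub_eq_zero_of_le h]

lemma levelCount_zero {l r G : ℕ} (hl : 0 < l) (hG : 0 < G) :
    levelCount l r G 0 = 1 + levelCount l r (G - l) 0 := by
  simp [levelCount, cdiv_eq_succ hl hG, add_comm]

/-- Pascal's rule, split by the first branching: a node with `k + 1` right branches on its path has
`k` of them left inside the right subtree, or all `k + 1` inside the left one. If `(k + 1) r ≥ G`,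
all terms vanish. -/
lemma levelCount_succ {l r G : ℕ} (hl : 0 < l) (k : ℕ) :
    levelCount l r G (k + 1) = levelCount l r (G - r) k + levelCount l r (G - l) (k + 1) := by
  have h1 : G - r - k * r = G - (k + 1) * r := by rw [Nat.succ_mul]; omega
  have h2 : G - l - (k + 1) * r = G - (k + 1) * r - l := by omega
  simp only [levelCount, h1, h2]
  rcases Nat.eq_zero_or_pos (G - (k + 1) * r) with h | h
  · simp [h]
  · rw [cdiv_eq_succ hl h, show k + 1 + (cdiv (G - (k + 1) * r - l) l + 1) =
      (k + 1 + cdiv (G - (k + 1) * r - l) l) + 1 by ring, Nat.choose_succ_succ,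
      show k + (cdiv (G - (k + 1) * r - l) l + 1) = k + 1 + cdiv (G - (k + 1) * r - l) l by ring]

/-- The `1` is the root. The range for `G - r` is shorter by one because a right branch has been
used. -/
lemma sum_levelCount_succ {l r G : ℕ} (hl : 0 < l) (hG : 0 < G) (N : ℕ) :
    ∑ k ∈ Finset.range (N + 1), levelCount l r G k =
      1 + ∑ k ∈ Finset.range (N + 1), levelCount l r (G - l) k +
        ∑ k ∈ Finset.range N, levelCount l r (G - r) k := by
  rw [Finset.sum_range_succ', Finset.sum_range_succ', levelCount_zero hl hG,
    Finset.sum_congr rfl fun k _ => levelCount_succ (G := G) (r := r) hl k,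
    Finset.sum_add_distrib]
  ring

/-- Terms beyond the depth vanish, so gaps of different depths can be summed over ranges of matching
length. -/
lemma sum_levelCount_eq {l r G : ℕ} (hr : 0 < r) {N : ℕ} (hN : cdiv G r ≤ N) :
    ∑ k ∈ Finset.range N, levelCount l r G k =
      ∑ k ∈ Finset.range (cdiv G r), levelCount l r G k := by
  refine (Finset.sum_subset (Finset.range_mono hN) fun k _ hk => ?_).symm
  rw [Finset.mem_range, not_lt, cdiv_le_iff hr] at hk
  exact levelCount_eq_zero hk

lemma closedForm_eq_depth_sum (x : BranchVar) (G : ℕ) :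
    closedForm x G = 1 + 2 * ∑ k ∈ Finset.range (cdiv G x.r), levelCount x.l x.r G k := by
  have hr : 0 < x.r := x.l_pos.trans x.l_le_r
  have shift := Finset.sum_Ico_add' (fun k => levelCount x.l x.r G (k - 1)) 0 (cdiv G x.r) 1
  simp only [Nat.add_sub_cancel, zero_add] at shift
  rw [closedForm, ceil_cast_div G hr, Finset.range_eq_Ico, shift]
  congr 2
  change Finset.sum (Finset.Icc 1 _) _ = Finset.sum (Finset.Icc 1 _) _
  refine Finset.sum_congr rfl fun k hk => ?_
  obtain ⟨hk1, hk2⟩ := Finset.mem_Icc.1 hk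
  obtain ⟨j, rfl⟩ : ∃ j, k = j + 1 := ⟨k - 1, by omega⟩
  have hj : j * x.r ≤ G := by
    by_contra h
    exact absurd ((cdiv_le_iff hr).2 (le_of_lt (not_le.1 h))) (by omega)
  have : (G : ℚ) - (((j + 1 : ℕ) : ℚ) - 1) * x.r = ((G - j * x.r : ℕ) : ℚ) := by
    push_cast [Nat.cast_sub hj]; ring
  rw [this, ceil_cast_div _ x.l_pos, Nat.add_sub_cancel, levelCount,
    show j + 1 + cdiv (G - j * x.r) x.l - 1 = j + cdiv (G - j * x.r) x.l by omega]

lemma closedForm_eq_sum (x : BranchVar) {G N : ℕ} (hN : cdiv G x.r ≤ N) :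
    closedForm x G = 1 + 2 * ∑ k ∈ Finset.range N, levelCount x.l x.r G k := by
  rw [closedForm_eq_depth_sum, sum_levelCount_eq (x.l_pos.trans x.l_le_r) hN]

lemma closedForm_zero (x : BranchVar) : closedForm x 0 = 1 := by
  simp [closedForm_eq_depth_sum]

lemma closedForm_rec (x : BranchVar) {G : ℕ} (hG : 0 < G) :
    closedForm x G = 1 + closedForm x (G - x.l) + closedForm x (G - x.r) := by
  have hr : 0 < x.r := x.l_pos.trans x.l_le_r
  rw [closedForm_eq_sum x ((cdiv_le_self hr).trans (Nat.le_succ G)),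
    closedForm_eq_sum x (G := G - x.l) (N := G + 1) ((cdiv_le_self hr).trans (by omega)),
    closedForm_eq_sum x (G := G - x.r) (N := G) ((cdiv_le_self hr).trans (by omega)),
    sum_levelCount_succ x.l_pos hG]
  ring

/-! ### The minimal tree -/

/-- The tree that branches on `x` exactly as long as the gap `G` is not closed. -/
def minTree (x : BranchVar) (G : ℕ) : BBTree :=
  if _h : G = 0 then .leaf
  else
    have := x.l_pos
    have := x.l_le_r
    .node x (minTree x (G - x.l)) (minTree x (G - x.r))
termination_by G

lemma minTree_zero (x : BranchVar) : minTree x 0 = .leaf := by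
  rw [minTree]; simp

lemma minTree_of_pos (x : BranchVar) {G : ℕ} (h : 0 < G) :
    minTree x G = .node x (minTree x (G - x.l)) (minTree x (G - x.r)) := by
  rw [minTree, dif_neg h.ne']

lemma minTree_induction (x : BranchVar) {P : ℕ → Prop} (zero : P 0)
    (step : ∀ G, 0 < G → P (G - x.l) → P (G - x.r) → P G) (G : ℕ) : P G := by
  have := x.l_pos
  have := x.l_le_r
  induction G using Nat.strong_induction_on with
  | _ G ih =>
    rcases Nat.eq_zero_or_pos G with rfl | h
    · exact zero
    · exact step G h (ih _ (by omega)) (ih _ (by omega))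

lemma minTree_vars (x : BranchVar) (G : ℕ) : (minTree x G).vars ⊆ {x} := by
  induction G using minTree_induction x with
  | zero => simp [minTree_zero, BBTree.vars]
  | step G h hl hr => 
    rw [minTree_of_pos x h]
    exact Set.union_subset (Set.union_subset subset_rfl hl) hr

lemma minTree_closes (x : BranchVar) (G : ℕ) :
    ∀ a, ∀ g ∈ (minTree x G).leafGaps a, G + a ≤ g := by
  induction G using minTree_induction x with
  | zero => simp [minTree_zero, BBTree.leafGaps]
  | step G h hl hr =>
    intro a g hg
    rw [minTree_of_pos x h, BBTree.leafGaps, List.mem_append] at hg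
    rcases hg with hg | hg
    · have := hl _ _ hg; omega
    · have := hr _ _ hg; omega

lemma minTree_size (x : BranchVar) (G : ℕ) : (minTree x G).size = closedForm x G := by
  induction G using minTree_induction x with
  | zero => simp [minTree_zero, BBTree.size, closedForm_zero]
  | step G h hl hr => rw [minTree_of_pos x h, BBTree.size, hl, hr, closedForm_rec x h]

lemma BBTree.size_pos (T : BBTree) : 0 < T.size := by
  cases T <;> simp [BBTree.size]

/-- The starting gap `a` is arbitrary so that the induction passes to subtrees. Optimality and
uniqueness go together: if the sizes of two nodes agree, optimality of both subtrees forces equality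
in each. -/
lemma minTree_least (x : BranchVar) (G : ℕ) (T : BBTree) :
    ∀ a, T.vars ⊆ {x} → (∀ g ∈ T.leafGaps a, G ≤ g) →
      (minTree x (G - a)).size ≤ T.size ∧
        (T.size ≤ (minTree x (G - a)).size → T = minTree x (G - a)) := by
  induction T with
  | leaf =>
    intro a _ h
    simp only [BBTree.leafGaps, List.mem_singleton, forall_eq] at h
    simp [Nat.sub_eq_zero_of_le h, minTree_zero]
  | node y L R hL hR =>
    intro a hv h
    simp only [BBTree.vars, Set.union_subset_iff, Set.singleton_subset_iff,
      Set.mem_singleton_iff] at hv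
    obtain ⟨⟨rfl, hvL⟩, hvR⟩ := hv
    simp only [BBTree.leafGaps, List.mem_append] at h
    obtain ⟨l1, l2⟩ := hL _ hvL fun g hg => h g (.inl hg)
    obtain ⟨r1, r2⟩ := hR _ hvR fun g hg => h g (.inr hg)
    have hs := L.size_pos
    -- If the gap is already closed, the leaf is strictly smaller than any node, so the uniqueness
    -- claim is vacuous.
    rcases Nat.eq_zero_or_pos (G - a) with h0 | h0
    · simp only [h0, minTree_zero, BBTree.size]
      exact ⟨by omega, fun h => by omega⟩
    · rw [← Nat.sub_sub] at l1 l2 r1 r2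
      rw [minTree_of_pos y h0]
      simp only [BBTree.size]
      exact ⟨by omega, fun h => by rw [l2 (by omega), r2 (by omega)]⟩

lemma minTree_isMinimalFor (x : BranchVar) (G : ℕ) : (minTree x G).IsMinimalFor x G :=
  ⟨⟨minTree_vars x G, fun g hg => by simpa using minTree_closes x G 0 g hg⟩,
    fun T hv hc => by simpa using (minTree_least x G T 0 hv hc).1⟩

lemma BBTree.IsMinimalFor.eq_minTree {x : BranchVar} {G : ℕ} {T : BBTree}
    (h : T.IsMinimalFor x G) : T = minTree x G := by
  have := (minTree_least x G T 0 h.1.1 h.1.2).2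
  rw [Nat.sub_zero] at this
  exact this (h.2 _ (minTree_isMinimalFor x G).1.1 (minTree_isMinimalFor x G).1.2)

lemma svbYes_iff (x : BranchVar) (G k : ℕ) : SVBYes x G k ↔ closedForm x G ≤ k := by
  rw [← minTree_size]
  exact ⟨fun ⟨T, hT, hk⟩ => hT.eq_minTree ▸ hk, fun h => ⟨_, minTree_isMinimalFor x G, h⟩⟩

/-- A tree closing `G'` also closes `G`; no estimate of the sum is needed. -/
lemma closedForm_mono (x : BranchVar) {G G' : ℕ} (h : G ≤ G') :
    closedForm x G ≤ closedForm x G' := by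
  rw [← minTree_size, ← minTree_size]
  have := (minTree_isMinimalFor x G).2 (minTree x G') (minTree_vars x G')
  exact this fun g hg => h.trans ((minTree_isMinimalFor x G').1.2 g hg)

/-- By monotonicity the left subtree is at least as large as the right one, whose depth parameter is
smaller by exactly one; so the bound doubles at each level. -/
lemma two_pow_depth_le (x : BranchVar) (G : ℕ) :
    2 ^ (depth x G + 1) - 1 ≤ closedForm x G := by
  rw [depth_eq]
  induction G using minTree_induction x with
  | zero => simp [closedForm_zero]
  | step G h hl hr =>
    rw [cdiv_eq_succ (x.l_pos.trans x.l_le_r) h, closedForm_rec x h, pow_succ]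
    have := closedForm_mono x (Nat.sub_le_sub_left x.l_le_r G)
    omega

/-! ### Binary numerals and serial arithmetic -/

/-- The value of a binary numeral, least significant bit first. -/
def bitsVal (A : List Bool) : ℕ := A.foldr Nat.bit 0

@[simp] lemma bitsVal_nil : bitsVal [] = 0 := rfl

@[simp] lemma bitsVal_cons (b : Bool) (A : List Bool) :
    bitsVal (b :: A) = b.toNat + 2 * bitsVal A := by
  simp only [bitsVal, List.foldr_cons, Nat.bit_val]; ring

lemma bitsVal_bits (n : ℕ) : bitsVal n.bits = n := by
  induction n using Nat.binaryRec' with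
  | zero => simp
  | bit b n h ih => rw [Nat.bits_append_bit _ _ h, bitsVal_cons, ih, Nat.bit_val]; ring

lemma bitsVal_lt (A : List Bool) : bitsVal A < 2 ^ A.length := by
  induction A with
  | nil => simp
  | cons b A ih =>
    rw [bitsVal_cons, List.length_cons, pow_succ]
    cases b <;> simp <;> omega

lemma length_bits_le {n W : ℕ} (h : n ≤ W) : n.bits.length ≤ W.size := by
  rw [Nat.size_eq_bits_len]; exact Nat.size_le_size h

/-- The sum bit of a full adder, which is also the difference bit of a full subtractor. -/
def sumBit (a b c : Bool) : Bool := xor a (xor b c)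

/-- The carry of a full adder, or the borrow of a full subtractor if `neg`. -/
def carryBit (neg a b c : Bool) : Bool :=
  bif neg then (!a && (b || c)) || (b && c) else (a && (b || c)) || (b && c)

/-- Serial addition (or subtraction, if `neg`) of numerals; returns the last carry (or borrow). -/
def serialOp (neg : Bool) : List Bool → List Bool → Bool → List Bool × Bool
  | [], [], c => (if (!neg && c) = true then [true] else [], c)
  | a :: A, [], c =>
    (sumBit a false c :: (serialOp neg A [] (carryBit neg a false c)).1,
      (serialOp neg A [] (carryBit neg a false c)).2)
  | [], b :: B, c =>
    (sumBit false b c :: (serialOp neg [] B (carryBit neg false b c)).1,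
      (serialOp neg [] B (carryBit neg false b c)).2)
  | a :: A, b :: B, c =>
    (sumBit a b c :: (serialOp neg A B (carryBit neg a b c)).1,
      (serialOp neg A B (carryBit neg a b c)).2)

lemma length_serialOp (neg : Bool) (A B : List Bool) (c : Bool) :
    (serialOp neg A B c).1.length ≤ max A.length B.length + 1 := by
  fun_induction serialOp neg A B c <;> simp_all; split <;> simp

lemma toNat_sumBit_add (a b c : Bool) :
    (sumBit a b c).toNat + 2 * (carryBit false a b c).toNat = a.toNat + b.toNat + c.toNat := by
  cases a <;> cases b <;> cases c <;> rfl

lemma toNat_sumBit_sub (a b c : Bool) :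
    (sumBit a b c).toNat + b.toNat + c.toNat = a.toNat + 2 * (carryBit true a b c).toNat := by
  cases a <;> cases b <;> cases c <;> rfl

lemma bitsVal_serialOp_add (A B : List Bool) (c : Bool) :
    bitsVal (serialOp false A B c).1 = bitsVal A + bitsVal B + c.toNat := by
  generalize hneg : false = neg
  fun_induction serialOp neg A B c with
  | case1 c => subst hneg; cases c <;> simp
  | case2 a A c ih =>
    subst hneg
    have := toNat_sumBit_add a false c
    simp_all; omega
  | case3 b B c ih =>
    subst hneg
    have := toNat_sumBit_add false b c
    simp_all; omega
  | case4 a A b B c ih =>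
    subst hneg
    have := toNat_sumBit_add a b c
    simp_all; omega

/-- The last borrow signals a negative difference. In that case the digits are meaningless and are
discarded later, which yields truncated subtraction. -/
lemma bitsVal_serialOp_sub (A B : List Bool) (c : Bool) :
    ((serialOp true A B c).2 = false →
      bitsVal (serialOp true A B c).1 + bitsVal B + c.toNat = bitsVal A) ∧
    ((serialOp true A B c).2 = true → bitsVal A < bitsVal B + c.toNat) := by
  generalize hneg : true = neg
  fun_induction serialOp neg A B c with
  | case1 c => subst hneg; cases c <;> simp
  | case2 a A c ih =>
    subst hneg
    have h := toNat_sumBit_sub a false c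
    have h1 := Bool.toNat_le (sumBit a false c)
    simp only [bitsVal_cons, bitsVal_nil, Bool.toNat_false] at ih h ⊢
    exact ⟨fun hc => by have := ih.1 hc; omega,
      fun hc => by have := ih.2 hc; omega⟩
  | case3 b B c ih =>
    subst hneg
    have h := toNat_sumBit_sub false b c
    have h1 := Bool.toNat_le (sumBit false b c)
    simp only [bitsVal_cons, bitsVal_nil, Bool.toNat_false] at ih h ⊢
    exact ⟨fun hc => by have := ih.1 hc; omega,
      fun hc => by have := ih.2 hc; omega⟩
  | case4 a A b B c ih =>
    subst hneg
    have h := toNat_sumBit_sub a b c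
    have h1 := Bool.toNat_le (sumBit a b c)
    simp only [bitsVal_cons] at ih h ⊢
    exact ⟨fun hc => by have := ih.1 hc; omega,
      fun hc => by have := ih.2 hc; omega⟩

/-- The in-place operations on natural numbers: addition, or truncated subtraction if `neg`. -/
def accVal (neg : Bool) (a b : ℕ) : ℕ := if neg then a - b else a + b

/-! ### The stacks of the simulating machine -/

/-- Stacks: input, output, two auxiliary stacks and `N` registers. -/
inductive Stk (N : ℕ) : Type
  | inp | out | t1 | t2
  | reg (i : Fin N)
  deriving DecidableEq, Fintype

/-- The stack alphabets. -/
@[reducible] def Alph (N : ℕ) : Stk N → Type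
  | .inp => Option Bool
  | _ => Bool

/-- The internal state: two symbols and a flag. -/
abbrev Vars : Type := Option Bool × Option Bool × Bool

/-- The internal state between two commands. -/
abbrev Vars.init : Vars := (none, none, false)

/-- Statements of the simulating machine. -/
abbrev MStmt (N : ℕ) (Λ : Type) : Type := Turing.TM2.Stmt (Alph N) Λ Vars

/-- Configurations of the simulating machine. -/
abbrev MCfg (N : ℕ) (Λ : Type) : Type := Turing.TM2.Cfg (Alph N) Λ Vars

variable {N : ℕ} {Λ : Type}

/-- The stack contents, given stack by stack. -/
def stks (w : List (Option Bool)) (o t u : List Bool) (R : Fin N → List Bool) :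
    ∀ k, List (Alph N k)
  | .inp => w
  | .out => o
  | .t1 => t
  | .t2 => u
  | .reg i => R i

section stks

variable (w w' : List (Option Bool)) (o t u A : List Bool) (R : Fin N → List Bool)

@[simp] lemma stks_inp : stks w o t u R .inp = w := rfl
@[simp] lemma stks_out : stks w o t u R .out = o := rfl
@[simp] lemma stks_t1 : stks w o t u R .t1 = t := rfl
@[simp] lemma stks_t2 : stks w o t u R .t2 = u := rfl
@[simp] lemma stks_reg (i : Fin N) : stks w o t u R (.reg i) = R i := rfl

@[simp] lemma update_stks_inp :
    Function.update (stks w o t u R) .inp w' = stks w' o t u R := by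
  funext k; cases k <;> simp [Function.update, stks]

@[simp] lemma update_stks_out :
    Function.update (stks w o t u R) .out A = stks w A t u R := by
  funext k; cases k <;> simp [Function.update, stks]

@[simp] lemma update_stks_t1 :
    Function.update (stks w o t u R) .t1 A = stks w o A u R := by
  funext k; cases k <;> simp [Function.update, stks]

@[simp] lemma update_stks_t2 :
    Function.update (stks w o t u R) .t2 A = stks w o t A R := by
  funext k; cases k <;> simp [Function.update, stks]

@[simp] lemma update_stks_reg (i : Fin N) :
    Function.update (stks w o t u R) (.reg i) A = stks w o t u (Function.update R i A) := by
  funext k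
  cases k with
  | reg j =>
    by_cases h : j = i
    · subst h; simp
    · simp [Function.update_of_ne, h]
  | _ => simp [Function.update, stks]

end stks

/-- The machine `M` gets from `c` to `c'` in at most `n` steps. -/
def Run (M : Λ → MStmt N Λ) (n : ℕ) (c c' : MCfg N Λ) : Prop :=
  Nonempty (StateTransition.EvalsToInTime (Turing.TM2.step M) c (some c') n)

section Run

variable {M : Λ → MStmt N Λ} {m n : ℕ} {a b c : MCfg N Λ}

lemma Run.refl (M : Λ → MStmt N Λ) (n : ℕ) (c : MCfg N Λ) : Run M n c c :=
  ⟨⟨⟨0, rfl⟩, Nat.zero_le n⟩⟩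

lemma Run.trans (h₁ : Run M m a b) (h₂ : Run M n b c) : Run M (m + n) a c := by
  obtain ⟨h₁⟩ := h₁
  obtain ⟨h₂⟩ := h₂
  rw [add_comm]
  exact ⟨h₁.trans _ _ _ _ _ _ h₂⟩

lemma Run.mono (h : Run M m a b) (hmn : m ≤ n) : Run M n a b := by
  obtain ⟨h⟩ := h
  exact ⟨⟨h.toEvalsTo, h.steps_le_m.trans hmn⟩⟩

lemma Run.single {l : Λ} {v : Vars} {S : ∀ k, List (Alph N k)}
    (h : Turing.TM2.stepAux (M l) v S = b) : Run M 1 ⟨some l, v, S⟩ b :=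
  ⟨⟨⟨1, by subst h; rfl⟩, le_rfl⟩⟩

lemma Run.head {l : Λ} {v : Vars} {S : ∀ k, List (Alph N k)}
    (h₂ : Run M n (Turing.TM2.stepAux (M l) v S) c) : Run M (n + 1) ⟨some l, v, S⟩ c := by
  rw [add_comm]; exact (Run.single rfl).trans h₂

end Run

/-! ### Machine statements for operations on registers -/

open Turing.TM2.Stmt

/-- Push the bits of `L`, the first one ending on top. -/
def pushBits (i : Fin N) : List Bool → MStmt N Λ → MStmt N Λ
  | [], q => q
  | b :: L, q => pushBits i L (push (.reg i) (fun _ => b) q)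

lemma stepAux_pushBits (i : Fin N) (w : List (Option Bool)) (o t u : List Bool) (v : Vars)
    (R : Fin N → List Bool) (L : List Bool) : ∀ q : MStmt N Λ,
    Turing.TM2.stepAux (pushBits i L q) v (stks w o t u R) =
      Turing.TM2.stepAux q v (stks w o t u (Function.update R i (L ++ R i))) := by
  induction L with
  | nil => intro q; simp [pushBits]
  | cons b L ih => intro q; simp [pushBits, ih]

/-- Empty register `i` and write `c` into it. -/
def setStmt (i : Fin N) (c : ℕ) (self next : Λ) : MStmt N Λ :=
  pop (.reg i) (fun _ a => (a, none, false)) <|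
    branch (fun v => v.1.isSome) (goto fun _ => self) <|
      load (fun _ => Vars.init) <| pushBits i c.bits <| goto fun _ => next

/-- Test whether register `i` is positive. -/
def testStmt (i : Fin N) (yes no : Λ) : MStmt N Λ :=
  peek (.reg i) (fun _ a => (a, none, false)) <|
    branch (fun v => v.1.isSome) (load (fun _ => Vars.init) <| goto fun _ => yes)
      (load (fun _ => Vars.init) <| goto fun _ => no)

/-- Serial addition or subtraction: consumes the registers `i` and `j`, writes the result
(reversed) to `t1` and a reversed copy of register `j` to `t2`. -/
def serialStmt (neg : Bool) (i j : Fin N) (self next : Λ) : MStmt N Λ :=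
  pop (.reg i) (fun v a => (a, v.2.1, v.2.2)) <|
    pop (.reg j) (fun v b => (v.1, b, v.2.2)) <|
      branch (fun v => v.1.isNone && v.2.1.isNone)
        (branch (fun v => !neg && v.2.2) (push .t1 (fun _ => true) <| goto fun _ => next)
          (goto fun _ => next)) <|
        push .t1 (fun v => sumBit (v.1.getD false) (v.2.1.getD false) v.2.2) <|
          load (fun v => (v.1, v.2.1, carryBit neg (v.1.getD false) (v.2.1.getD false) v.2.2)) <|
            branch (fun v => v.2.1.isSome)
              (push .t2 (fun v => v.2.1.getD false) <| goto fun _ => self) (goto fun _ => self)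

/-- Move `t1` to register `i`, dropping leading zeros (and everything, if a subtraction has left
a borrow). -/
def unwindStmt (neg : Bool) (i : Fin N) (self next : Λ) : MStmt N Λ :=
  pop .t1 (fun v a => (a, v.2.1, v.2.2)) <| peek (.reg i) (fun v b => (v.1, b, v.2.2)) <|
    branch (fun v => v.1.isNone) (goto fun _ => next) <|
      branch (fun v => (neg && v.2.2) || (v.2.1.isNone && !v.1.getD false)) (goto fun _ => self) <|
        push (.reg i) (fun v => v.1.getD false) <| goto fun _ => self

/-- Move `t2` to register `j`. -/
def restoreStmt (j : Fin N) (self next : Λ) : MStmt N Λ :=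
  pop .t2 (fun _ a => (a, none, false)) <|
    branch (fun v => v.1.isSome) (push (.reg j) (fun v => v.1.getD false) <| goto fun _ => self) <|
      load (fun _ => Vars.init) <| goto fun _ => next

lemma update_update_left {i j : Fin N} (hij : i ≠ j) (R : Fin N → List Bool)
    (A B A' : List Bool) :
    Function.update (Function.update (Function.update R i A) j B) i A' =
      Function.update (Function.update R i A') j B := by
  rw [Function.update_comm hij, Function.update_idem, Function.update_comm hij.symm]

section statements

variable {M : Λ → MStmt N Λ} {self next : Λ} {w : List (Option Bool)} {o t u : List Bool}
  {R : Fin N → List Bool}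

lemma run_setStmt {i : Fin N} {c : ℕ} (hM : M self = setStmt i c self next) (A : List Bool) :
    ∀ v : Vars, Run M (A.length + 1) ⟨some self, v, stks w o t u (Function.update R i A)⟩
      ⟨some next, Vars.init, stks w o t u (Function.update R i c.bits)⟩ := by
  induction A with
  | nil =>
    intro v
    refine Run.single ?_
    simp [hM, setStmt, stepAux_pushBits]
  | cons a A ih =>
    intro v
    refine Run.head ?_
    simpa [hM, setStmt] using ih _

lemma run_testStmt {i : Fin N} {yes no : Λ} (hM : M self = testStmt i yes no) (v : Vars) :
    Run M 1 ⟨some self, v, stks w o t u R⟩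
      ⟨some (if R i = [] then no else yes), Vars.init, stks w o t u R⟩ := by
  refine Run.single ?_
  cases h : R i <;> simp [hM, testStmt, h]

/-- The flag of the internal state is the carry. An exhausted stack is read as the bit `false`, so
numerals of different lengths need no padding. -/
lemma run_serialStmt {neg : Bool} {i j : Fin N} (hij : i ≠ j)
    (hM : M self = serialStmt neg i j self next) (A B : List Bool) (c : Bool) :
    ∀ (a b : Option Bool) (t u : List Bool), Run M (max A.length B.length + 1)
      ⟨some self, (a, b, c), stks w o t u (Function.update (Function.update R i A) j B)⟩
      ⟨some next, (none, none, (serialOp neg A B c).2),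
        stks w o ((serialOp neg A B c).1.reverse ++ t) (B.reverse ++ u)
          (Function.update (Function.update R i []) j [])⟩ := by
  fun_induction serialOp neg A B c with
  | case1 c =>
    intro a b t u
    refine Run.single ?_
    by_cases h : (!neg && c) = true <;>
      simp [hM, serialStmt, hij.symm, Function.update_comm hij, h]
  | case2 a A c ih =>
    intro a' b' t u
    refine Run.head ?_
    simpa [hM, serialStmt, hij, update_update_left hij] using ih _ _ _ _
  | case3 b B c ih =>
    intro a' b' t u
    refine Run.head ?_
    simpa [hM, serialStmt, hij, update_update_left hij] using ih _ _ _ _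
  | case4 a A b B c ih =>
    intro a' b' t u
    refine Run.mono (m := max A.length B.length + 1 + 1) (Run.head ?_) (by simp)
    simpa [hM, serialStmt, hij, update_update_left hij] using ih _ _ _ _

/-- The most significant bit arrives first, so each push is an application of `Nat.bit`. A zero bit
arriving on an empty register is dropped: registers thus stay canonical numerals, and testing for
zero is testing for emptiness. -/
lemma run_unwindStmt {neg : Bool} {i : Fin N} (hM : M self = unwindStmt neg i self next)
    (c : Bool) (T : List Bool) : ∀ (n : ℕ) (a b : Option Bool), ∃ b' : Option Bool,
    Run M (T.length + 1) ⟨some self, (a, b, c), stks w o T u (Function.update R i n.bits)⟩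
      ⟨some next, (none, b', c), stks w o [] u (Function.update R i
        (if neg && c then n else T.foldl (fun n b => Nat.bit b n) n).bits)⟩ := by
  induction T with
  | nil =>
    intro n a b
    refine ⟨n.bits.head?, Run.single ?_⟩
    simp [hM, unwindStmt]
  | cons d T ih =>
    intro n a b
    by_cases hc : (neg && c) = true
    · obtain ⟨b', h⟩ := ih n (some d) n.bits.head?
      refine ⟨b', Run.head ?_⟩
      simpa [hM, unwindStmt, hc] using h
    · by_cases hd : n.bits = [] ∧ d = false
      · obtain ⟨b', h⟩ := ih n (some d) n.bits.head?
        refine ⟨b', Run.head ?_⟩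
        have hn : n = 0 := by simpa [hd.1] using (bitsVal_bits n).symm
        subst hn
        simpa [hM, unwindStmt, hc, hd] using h
      · obtain ⟨b', h⟩ := ih (Nat.bit d n) (some d) n.bits.head?
        have hbits : (Nat.bit d n).bits = d :: n.bits := Nat.bits_append_bit _ _ fun hn => by
          by_contra hd'
          exact hd ⟨by simp [hn], by simpa using hd'⟩
        refine ⟨b', Run.head ?_⟩
        have hd' : (n.bits.head?.isNone && !d) = false := by
          cases hb : n.bits <;> simp_all
        rw [hbits] at h
        simpa [hM, unwindStmt, hc, hd'] using h

lemma run_restoreStmt {j : Fin N} (hM : M self = restoreStmt j self next) (U : List Bool) :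
    ∀ (v : Vars) (B : List Bool), Run M (U.length + 1)
      ⟨some self, v, stks w o t U (Function.update R j B)⟩
      ⟨some next, Vars.init, stks w o t [] (Function.update R j (U.reverse ++ B))⟩ := by
  induction U with
  | nil =>
    intro v B
    refine Run.single ?_
    simp [hM, restoreStmt]
  | cons d U ih =>
    intro v B
    refine Run.head ?_
    simpa [hM, restoreStmt] using ih _ _

end statements

/-! ### A language of register commands and its compilation -/

/-- Commands on natural-number registers. -/
inductive Cmd : Type
  /-- `i := c` -/
  | set (i c : ℕ) : Cmd
  /-- `i := i + j`, or `i := i - j` (truncated) if `neg` -/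
  | acc (neg : Bool) (i j : ℕ) : Cmd
  | seq (p q : Cmd) : Cmd
  /-- `if i > 0 then p else q` -/
  | ite (i : ℕ) (p q : Cmd) : Cmd
  /-- `while i > 0 do p` -/
  | loop (i : ℕ) (p : Cmd) : Cmd

namespace Cmd

/-- All registers are below `N`, and in-place operations have two different registers. -/
def Below (N : ℕ) : Cmd → Prop
  | set i _ => i < N
  | acc _ i j => i < N ∧ j < N ∧ i ≠ j
  | seq p q => p.Below N ∧ q.Below N
  | ite i p q => i < N ∧ p.Below N ∧ q.Below N
  | loop i p => i < N ∧ p.Below N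

/-- `Exec W p s s' n`: started with register contents `s`, the command `p` halts with contents `s'`
after at most `n` operations, writing no number larger than `W`. -/
inductive Exec (W : ℕ) : Cmd → (ℕ → ℕ) → (ℕ → ℕ) → ℕ → Prop
  | set (i c : ℕ) (s : ℕ → ℕ) (h : c ≤ W) : Exec W (.set i c) s (Function.update s i c) 1
  | acc (neg : Bool) (i j : ℕ) (s : ℕ → ℕ) (h : accVal neg (s i) (s j) ≤ W) :
      Exec W (.acc neg i j) s (Function.update s i (accVal neg (s i) (s j))) 1
  | seq {p q : Cmd} {s s' s'' : ℕ → ℕ} {m n : ℕ} :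
      Exec W p s s' m → Exec W q s' s'' n → Exec W (.seq p q) s s'' (m + n)
  | ite_pos {i : ℕ} {p q : Cmd} {s s' : ℕ → ℕ} {n : ℕ} :
      0 < s i → Exec W p s s' n → Exec W (.ite i p q) s s' (n + 1)
  | ite_neg {i : ℕ} {p q : Cmd} {s s' : ℕ → ℕ} {n : ℕ} :
      s i = 0 → Exec W q s s' n → Exec W (.ite i p q) s s' (n + 1)
  | loop_pos {i : ℕ} {p : Cmd} {s s' s'' : ℕ → ℕ} {m n : ℕ} :
      0 < s i → Exec W p s s' m → Exec W (.loop i p) s' s'' n →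
        Exec W (.loop i p) s s'' (m + n + 1)
  | loop_neg {i : ℕ} {p : Cmd} {s : ℕ → ℕ} :
      s i = 0 → Exec W (.loop i p) s s 1
  | mono {p : Cmd} {s s' : ℕ → ℕ} {m n : ℕ} : Exec W p s s' m → m ≤ n → Exec W p s s' n

lemma Exec.le {W : ℕ} {p : Cmd} {s s' : ℕ → ℕ} {n : ℕ} (h : Exec W p s s' n)
    (hs : ∀ i, s i ≤ W) : ∀ i, s' i ≤ W := by
  induction h with
  | set i c s h =>
    intro k
    rcases eq_or_ne k i with rfl | hk <;> simp [*]
  | acc neg i j s h =>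
    intro k
    rcases eq_or_ne k i with rfl | hk <;> simp [*]
  | seq _ _ ih₁ ih₂ => exact ih₂ (ih₁ hs)
  | ite_pos _ _ ih => exact ih hs
  | ite_neg _ _ ih => exact ih hs
  | loop_pos _ _ _ ih₁ ih₂ => exact ih₂ (ih₁ hs)
  | loop_neg => exact hs
  | mono _ _ ih => exact ih hs

/-- The labels of the compiled command. -/
def Lab : Cmd → Type
  | set _ _ => Unit
  | acc _ _ _ => Fin 3
  | seq p q => p.Lab ⊕ q.Lab
  | ite _ p q => Option (p.Lab ⊕ q.Lab)
  | loop _ p => Option p.Lab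

/-- There are finitely many labels. -/
@[reducible] def labFintype : ∀ p : Cmd, Fintype p.Lab
  | set _ _ => inferInstanceAs (Fintype Unit)
  | acc _ _ _ => inferInstanceAs (Fintype (Fin 3))
  | seq p q => @instFintypeSum _ _ p.labFintype q.labFintype
  | ite _ p q => @instFintypeOption _ (@instFintypeSum _ _ p.labFintype q.labFintype)
  | loop _ p => @instFintypeOption _ p.labFintype

/-- The first label. -/
def entry : ∀ p : Cmd, p.Lab
  | set _ _ => ()
  | acc _ _ _ => (0 : Fin 3)
  | seq p _ => .inl p.entry
  | ite _ _ _ => none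
  | loop _ _ => none

/-- The statements for an in-place operation. -/
def accCode {N : ℕ} {Λ : Type} (neg : Bool) (i j : Fin N) (e : Fin 3 → Λ) (x : Λ) :
    Fin 3 → MStmt N Λ
  | 0 => serialStmt neg i j (e 0) (e 1)
  | 1 => unwindStmt neg i (e 1) (e 2)
  | 2 => restoreStmt j (e 2) x

/-- The compiled command: labels are embedded by `e`, and control is passed on to `x`. -/
def code {N : ℕ} [NeZero N] {Λ : Type} : ∀ p : Cmd, (p.Lab → Λ) → Λ → p.Lab → MStmt N Λ
  | set i c, e, x, _ => setStmt (Fin.ofNat N i) c (e ()) x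
  | acc neg i j, e, x, l => accCode neg (Fin.ofNat N i) (Fin.ofNat N j) e x l
  | seq p _, e, _, .inl l => p.code (fun l => e (.inl l)) (e (.inr (entry _))) l
  | seq _ q, e, x, .inr l => q.code (fun l => e (.inr l)) x l
  | ite i p q, e, _, none =>
    testStmt (Fin.ofNat N i) (e (some (.inl p.entry))) (e (some (.inr q.entry)))
  | ite _ p _, e, x, some (.inl l) => p.code (fun l => e (some (.inl l))) x l
  | ite _ _ q, e, x, some (.inr l) => q.code (fun l => e (some (.inr l))) x l
  | loop i p, e, x, none => testStmt (Fin.ofNat N i) (e (some p.entry)) x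
  | loop _ p, e, _, some l => p.code (fun l => e (some l)) (e none) l

end Cmd

/-- The register stacks holding the numbers `s`. -/
def regs (N : ℕ) (s : ℕ → ℕ) : Fin N → List Bool := fun i => (s i).bits

/-! ### Simulation of commands by the machine -/

section

variable {N : ℕ} [NeZero N] {Λ : Type} {M : Λ → MStmt N Λ} {w : List (Option Bool)}
  {o : List Bool}

lemma val_ofNat_of_lt {i : ℕ} (hi : i < N) : (Fin.ofNat N i).val = i := Nat.mod_eq_of_lt hi

lemma update_regs (s : ℕ → ℕ) {i : ℕ} (hi : i < N) (c : ℕ) :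
    Function.update (regs N s) (Fin.ofNat N i) c.bits = regs N (Function.update s i c) := by
  funext k
  rcases eq_or_ne k (Fin.ofNat N i) with rfl | hk
  · simp [regs, Nat.mod_eq_of_lt hi]
  · have : (k : ℕ) ≠ i := fun h => hk (Fin.ext (by rw [val_ofNat_of_lt hi, h]))
    rw [Function.update_of_ne hk]
    simp [regs, this]

lemma regs_ofNat (s : ℕ → ℕ) {i : ℕ} (hi : i < N) :
    regs N s (Fin.ofNat N i) = (s i).bits := by
  simp [regs, Nat.mod_eq_of_lt hi]

lemma bits_eq_nil_iff {n : ℕ} : n.bits = [] ↔ n = 0 :=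
  ⟨fun h => by rw [← bitsVal_bits n, h]; rfl, fun h => by simp [h]⟩

lemma run_test {i : ℕ} (hi : i < N) {self yes no : Λ}
    (hM : M self = testStmt (Fin.ofNat N i) yes no) (s : ℕ → ℕ) :
    Run M 1 ⟨some self, Vars.init, stks w o [] [] (regs N s)⟩
      ⟨some (if s i = 0 then no else yes), Vars.init, stks w o [] [] (regs N s)⟩ := by
  simpa only [regs_ofNat s hi, bits_eq_nil_iff] using
    run_testStmt (w := w) (o := o) (t := []) (u := []) (R := regs N s) hM Vars.init

/-- Three passes over at most `b = W.size` bits: `b + 1` steps for the arithmetic, `b + 2` to unwind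
a result that may be one bit longer, `b + 1` to restore register `j`. -/
lemma run_acc {neg : Bool} {i j W : ℕ} (hi : i < N) (hj : j < N) (hij : i ≠ j)
    {l₀ l₁ l₂ x : Λ}
    (h₀ : M l₀ = serialStmt neg (Fin.ofNat N i) (Fin.ofNat N j) l₀ l₁)
    (h₁ : M l₁ = unwindStmt neg (Fin.ofNat N i) l₁ l₂)
    (h₂ : M l₂ = restoreStmt (Fin.ofNat N j) l₂ x) (s : ℕ → ℕ)
    (hsi : s i ≤ W) (hsj : s j ≤ W) :
    Run M (3 * W.size + 4) ⟨some l₀, Vars.init, stks w o [] [] (regs N s)⟩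
      ⟨some x, Vars.init, stks w o [] [] (regs N (Function.update s i
        (accVal neg (s i) (s j))))⟩ := by
  have hij' : Fin.ofNat N i ≠ Fin.ofNat N j := fun h => hij (by
    rw [← val_ofNat_of_lt hi, ← val_ofNat_of_lt hj, h])
  set I := Fin.ofNat N i with hI
  set J := Fin.ofNat N j with hJ
  set S := serialOp neg (s i).bits (s j).bits false with hS
  have e1 : ∀ A : List Bool, Function.update (Function.update (regs N s) I A) J [] =
      Function.update (Function.update (regs N s) J []) I A :=
    fun A => Function.update_comm hij' _ _ _
  have r0 := run_serialStmt (w := w) (o := o) (R := regs N s) hij' h₀ (s i).bits (s j).bits false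
    none none [] []
  obtain ⟨b, r1⟩ := run_unwindStmt (w := w) (o := o) (u := (s j).bits.reverse)
    (R := Function.update (regs N s) J []) h₁ S.2 S.1.reverse 0 none none
  have r2 := fun v => run_restoreStmt (w := w) (o := o) (t := [])
    (R := Function.update (regs N s) I (accVal neg (s i) (s j)).bits) h₂ (s j).bits.reverse v []
  have hself : Function.update (Function.update (regs N s) I (s i).bits) J (s j).bits =
      regs N s := by
    rw [← regs_ofNat s hi, ← regs_ofNat s hj, Function.update_eq_self, Function.update_eq_self]
  have hfin : Function.update (Function.update (regs N s) I (accVal neg (s i) (s j)).bits) J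
      (s j).bits = regs N (Function.update s i (accVal neg (s i) (s j))) := by
    have := Function.update_of_ne hij.symm (accVal neg (s i) (s j)) s
    rw [update_regs s hi, ← congrArg Nat.bits this, update_regs _ hj, Function.update_eq_self]
  have hval : (if (neg && S.2) = true then 0
      else S.1.reverse.foldl (fun n b => Nat.bit b n) 0) = accVal neg (s i) (s j) := by
    rw [List.foldl_reverse]
    change (if _ then 0 else bitsVal S.1) = _
    cases neg
    · simp [hS, bitsVal_serialOp_add, bitsVal_bits, accVal]
    · have := bitsVal_serialOp_sub (s i).bits (s j).bits false
      rw [← hS] at this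
      simp only [bitsVal_bits, Bool.toNat_false, add_zero] at this
      cases hc : S.2
      · have := this.1 hc
        simp [accVal]; omega
      · have := this.2 hc
        simp [accVal]; omega
  rw [hself, ← hS, List.append_nil, List.append_nil] at r0
  rw [hval, Nat.zero_bits, ← e1, ← e1] at r1
  simp only [List.reverse_reverse, List.append_nil, hfin] at r2
  refine ((r0.trans r1).trans (r2 _)).mono ?_
  have := length_bits_le hsi
  have := length_bits_le hsj
  have := length_serialOp neg (s i).bits (s j).bits false
  rw [← hS] at this
  simp only [List.length_reverse]
  omega

/-- The embedding `e` and the exit `x` are arbitrary, so the induction covers a command at any place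
of a larger machine; for a loop, the exit of the body is the test itself. The factor is the cost of
an in-place operation, the most expensive single one. -/
theorem run_code {W : ℕ} {p : Cmd} {s s' : ℕ → ℕ} {n : ℕ} (h : p.Exec W s s' n) :
    ∀ (e : p.Lab → Λ) (x : Λ), (∀ l, M (e l) = p.code e x l) → p.Below N → (∀ i, s i ≤ W) →
      Run M (n * (3 * W.size + 4)) ⟨some (e p.entry), Vars.init, stks w o [] [] (regs N s)⟩
        ⟨some x, Vars.init, stks w o [] [] (regs N s')⟩ := by
  induction h with
  | set i c s h =>
    intro e x hM hb hs
    have r := run_setStmt (w := w) (o := o) (t := []) (u := []) (R := regs N s) (hM ())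
      (s i).bits Vars.init
    rw [← regs_ofNat s hb, Function.update_eq_self, update_regs s hb, regs_ofNat s hb] at r
    have := length_bits_le (hs i)
    exact r.mono (by omega)
  | acc neg i j s h =>
    intro e x hM hb hs
    obtain ⟨hi, hj, hij⟩ := hb
    rw [one_mul]
    have hM' : ∀ l : Fin 3, M (e l) = Cmd.accCode neg (Fin.ofNat N i) (Fin.ofNat N j) e x l := hM
    exact run_acc hi hj hij (hM' 0) (hM' 1) (hM' 2) s (hs i) (hs j)
  | seq h₁ h₂ ih₁ ih₂ =>
    intro e x hM hb hs
    rw [add_mul]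
    exact (ih₁ _ _ (fun l => hM (.inl l)) hb.1 hs).trans
      (ih₂ _ _ (fun l => hM (.inr l)) hb.2 (h₁.le hs))
  | @ite_pos i p q s s' n h h₁ ih =>
    intro e x hM hb hs
    have r := run_test (w := w) (o := o) hb.1 (hM none) s
    rw [if_neg h.ne'] at r
    exact (r.trans (ih _ _ (fun l => hM (some (.inl l))) hb.2.1 hs)).mono
      (by rw [add_mul]; omega)
  | @ite_neg i p q s s' n h h₁ ih =>
    intro e x hM hb hs
    have r := run_test (w := w) (o := o) hb.1 (hM none) s
    rw [if_pos h] at r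
    exact (r.trans (ih _ _ (fun l => hM (some (.inr l))) hb.2.2 hs)).mono
      (by rw [add_mul]; omega)
  | @loop_pos i p s s' s'' m n h h₁ h₂ ih₁ ih₂ =>
    intro e x hM hb hs
    have r := run_test (w := w) (o := o) hb.1 (hM none) s
    rw [if_neg h.ne'] at r
    exact ((r.trans (ih₁ _ _ (fun l => hM (some l)) hb.2 hs)).trans
      (ih₂ e x hM hb (h₁.le hs))).mono (by rw [add_mul, add_mul]; omega)
  | @loop_neg i p s h =>
    intro e x hM hb hs
    have r := run_test (w := w) (o := o) hb.1 (hM none) s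
    rw [if_pos h] at r
    exact r.mono (by omega)
  | mono h hmn ih =>
    intro e x hM hb hs
    exact (ih e x hM hb hs).mono (Nat.mul_le_mul_right _ hmn)

end

/-! ### Programs with nonnegative operands and bounded values -/

/-- `Prog.Bounded W p s s' n`: an execution as in `Exec` in which all operands are nonnegative, all
divisors are positive, and no value written exceeds `W`. -/
inductive Prog.Bounded (W : ℕ) : Prog → (ℕ → ℤ) → (ℕ → ℤ) → ℕ → Prop
  | const (i : ℕ) (c : ℤ) (s : ℕ → ℤ) (h : c ≤ W) :
      Bounded W (.const i c) s (Function.update s i c) 1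
  | op (o : ArithOp) (i j k : ℕ) (s : ℕ → ℤ) (hj : 0 ≤ s j) (hk : 0 ≤ s k)
      (hdiv : o = .div → 0 < s k) (h : o.eval (s j) (s k) ≤ W) :
      Bounded W (.op o i j k) s (Function.update s i (o.eval (s j) (s k))) 1
  | seq {p q : Prog} {s s' s'' : ℕ → ℤ} {m n : ℕ} :
      Bounded W p s s' m → Bounded W q s' s'' n → Bounded W (.seq p q) s s'' (m + n)
  | ite_pos {i : ℕ} {p q : Prog} {s s' : ℕ → ℤ} {n : ℕ} :
      0 < s i → Bounded W p s s' n → Bounded W (.ite i p q) s s' (n + 1)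
  | ite_neg {i : ℕ} {p q : Prog} {s s' : ℕ → ℤ} {n : ℕ} :
      s i ≤ 0 → Bounded W q s s' n → Bounded W (.ite i p q) s s' (n + 1)
  | loop_pos {i : ℕ} {p : Prog} {s s' s'' : ℕ → ℤ} {m n : ℕ} :
      0 < s i → Bounded W p s s' m → Bounded W (.loop i p) s' s'' n →
        Bounded W (.loop i p) s s'' (m + n + 1)
  | loop_neg {i : ℕ} {p : Prog} {s : ℕ → ℤ} :
      s i ≤ 0 → Bounded W (.loop i p) s s 1

lemma Prog.Bounded.exec {W : ℕ} {p : Prog} {s s' : ℕ → ℤ} {n : ℕ} (h : p.Bounded W s s' n) :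
    Exec p s s' n := by
  induction h with
  | const i c s => exact .const i c s
  | op o i j k s => exact .op o i j k s
  | seq _ _ ih₁ ih₂ => exact .seq ih₁ ih₂
  | ite_pos h _ ih => exact .ite_pos h ih
  | ite_neg h _ ih => exact .ite_neg h ih
  | loop_pos h _ _ ih₁ ih₂ => exact .loop_pos h ih₁ ih₂
  | loop_neg h => exact .loop_neg h

lemma Prog.Bounded.le {W : ℕ} {p : Prog} {s s' : ℕ → ℤ} {n : ℕ} (h : p.Bounded W s s' n)
    (hs : ∀ i, s i ≤ W) : ∀ i, s' i ≤ W := by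
  induction h with
  | const i c s h =>
    intro k
    rcases eq_or_ne k i with rfl | hk <;> simp [*]
  | op o i j k s _ _ _ h =>
    intro k
    rcases eq_or_ne k i with rfl | hk <;> simp [*]
  | seq _ _ ih₁ ih₂ => exact ih₂ (ih₁ hs)
  | ite_pos _ _ ih => exact ih hs
  | ite_neg _ _ ih => exact ih hs
  | loop_pos _ _ _ ih₁ ih₂ => exact ih₂ (ih₁ hs)
  | loop_neg => exact hs

namespace Cmd

/-! ### Multiplication and division by repeated doubling -/

/-- `i := j` -/
def copy (i j : ℕ) : Cmd := .seq (.set i 0) (.acc false i j)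

/-- `i := i + i`, using the register `6`. -/
def double (i : ℕ) : Cmd := .seq (copy 6 i) (.acc false i 6)

/-- `6 := 0 + 1 - 2 * 5`, where the numbers denote registers (except in `+ 1` and `2 *`). -/
def testDouble : Cmd :=
  .seq (.seq (.set 6 1) (.acc false 6 0)) (.seq (.acc true 6 5) (.acc true 6 5))

/-- `6 := 0 + 1 - 2`, where `0`, `2`, `6` denote registers. -/
def testGe : Cmd := .seq (.seq (.set 6 1) (.acc false 6 0)) (.acc true 6 2)

/-- Double the registers `4` and `5` while register `5` does not exceed register `0`. -/
def scaleUp : Cmd := .loop 6 (.seq (.seq (double 5) (double 4)) testDouble)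

/-- Subtract the largest scaling of register `2` from register `0`, and add the same scaling of
register `1` to register `3`. -/
def reduceOnce : Cmd :=
  .seq (.seq (.seq (copy 4 1) (copy 5 2)) (.seq testDouble scaleUp))
    (.seq (.seq (.acc true 0 5) (.acc false 3 4)) testGe)

/-- `3 := (0 / 2) * 1`, where the numbers denote registers. -/
def mulDiv : Cmd := .seq (.seq (.set 3 0) testGe) (.loop 6 reduceOnce)

variable {W : ℕ} {s : ℕ → ℕ}

lemma exec_copy {i j : ℕ} (hij : i ≠ j) (h : s j ≤ W) :
    Exec W (copy i j) s (Function.update s i (s j)) 2 := by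
  have h1 := Exec.set (W := W) i 0 s (Nat.zero_le W)
  have h2 := Exec.acc (W := W) false i j (Function.update s i 0)
    (by simpa [accVal, hij.symm] using h)
  simpa [copy, accVal, hij.symm] using h1.seq h2

lemma exec_double {i : ℕ} (hi : i ≠ 6) (h : 2 * s i ≤ W) :
    Exec W (double i) s (Function.update (Function.update s 6 (s i)) i (2 * s i)) 3 := by
  have h1 := exec_copy (W := W) (s := s) hi.symm (by omega)
  have h2 := Exec.acc (W := W) false i 6 (Function.update s 6 (s i))
    (by simp [accVal, hi]; omega)
  simpa [double, accVal, hi, two_mul] using h1.seq h2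

lemma exec_testDouble (h : s 0 + 1 ≤ W) :
    Exec W testDouble s (Function.update s 6 (s 0 + 1 - 2 * s 5)) 4 := by
  have h1 := Exec.set (W := W) 6 1 s (by omega)
  have h2 := Exec.acc (W := W) false 6 0 (Function.update s 6 1) (by simp [accVal]; omega)
  have h3 := Exec.acc (W := W) true 6 5 (Function.update s 6 (1 + s 0)) (by simp [accVal]; omega)
  have h4 := Exec.acc (W := W) true 6 5 (Function.update s 6 (1 + s 0 - s 5))
    (by simp [accVal]; omega)
  simp [accVal] at h2 h3 h4
  have := (h1.seq h2).seq (h3.seq h4)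
  rwa [show 1 + s 0 - s 5 - s 5 = s 0 + 1 - 2 * s 5 by omega] at this

lemma exec_testGe (h : s 0 + 1 ≤ W) :
    Exec W testGe s (Function.update s 6 (s 0 + 1 - s 2)) 3 := by
  have h1 := Exec.set (W := W) 6 1 s (by omega)
  have h2 := Exec.acc (W := W) false 6 0 (Function.update s 6 1) (by simp [accVal]; omega)
  have h3 := Exec.acc (W := W) true 6 2 (Function.update s 6 (1 + s 0)) (by simp [accVal]; omega)
  simp [accVal] at h2 h3
  have := (h1.seq h2).seq h3
  rwa [add_comm 1] at this

/-- Register `6` is positive exactly when register `5` can be doubled without exceeding register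
`0`, and `k` bounds the doublings left. A round costs `3 + 3 + 4 + 1 = 11`. The hypothesis on all
`b` keeps the scaled multiplier in register `4` below `W`. -/
lemma exec_scaleUp (k : ℕ) : ∀ s : ℕ → ℕ, s 0 + 1 ≤ W → s 6 = s 0 + 1 - 2 * s 5 →
    s 5 ≤ s 0 → s 0 < 2 ^ k * s 5 → (∀ b, 2 ^ b * s 5 ≤ s 0 → 2 ^ b * s 4 ≤ W) →
    ∃ (s' : ℕ → ℕ) (b : ℕ), Exec W scaleUp s s' (k * 11 + 1) ∧ s' 5 = 2 ^ b * s 5 ∧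
      s' 4 = 2 ^ b * s 4 ∧ s' 5 ≤ s 0 ∧ s 0 < 2 * s' 5 ∧
      ∀ i, i ≠ 4 → i ≠ 5 → i ≠ 6 → s' i = s i := by
  induction k with
  | zero => intro s _ _ h h' _; omega
  | succ k ih =>
    intro s hW h6 h5 hk hb
    rcases Nat.lt_or_ge (s 0) (2 * s 5) with hlt | hge
    · refine ⟨s, 0, (Exec.loop_neg (by omega)).mono (by omega), by simp, by simp, h5, hlt,
        fun i _ _ _ => rfl⟩
    · have h4 := hb 1 (by simpa using hge)
      have e1 := exec_double (W := W) (s := s) (i := 5) (by norm_num) (by omega)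
      set s1 := Function.update (Function.update s 6 (s 5)) 5 (2 * s 5) with hs1
      have e2 := exec_double (W := W) (s := s1) (i := 4) (by norm_num) (by simp [hs1]; omega)
      set s2 := Function.update (Function.update s1 6 (s1 4)) 4 (2 * s1 4) with hs2
      have e3 := exec_testDouble (W := W) (s := s2) (by simp [hs2, hs1]; omega)
      set s3 := Function.update s2 6 (s2 0 + 1 - 2 * s2 5) with hs3
      have v0 : s3 0 = s 0 := by simp [hs3, hs2, hs1]
      have v4 : s3 4 = 2 * s 4 := by simp [hs3, hs2, hs1]
      have v5 : s3 5 = 2 * s 5 := by simp [hs3, hs2, hs1]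
      have v6 : s3 6 = s 0 + 1 - 2 * (2 * s 5) := by simp [hs3, hs2, hs1]
      have vi : ∀ i, i ≠ 4 → i ≠ 5 → i ≠ 6 → s3 i = s i := by
        intro i h4 h5 h6; simp [hs3, hs2, hs1, h4, h5, h6]
      obtain ⟨s', b, e, r5, r4, rle, rlt, ri⟩ := ih s3 (by omega) (by omega) (by omega)
        (by rw [v0, v5]; rw [pow_succ] at hk; linarith)
        (fun b h => by
          have := hb (b + 1) (by rw [v0, v5] at h; rw [pow_succ]; linarith)
          rw [v4]; rw [pow_succ] at this; linarith)
      refine ⟨s', b + 1, (Exec.loop_pos (by omega) ((e1.seq e2).seq e3) e).mono (by omega),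
        by rw [r5, v5, pow_succ]; ring, by rw [r4, v4, pow_succ]; ring, by omega, by omega,
        fun i h4 h5 h6 => by rw [ri i h4 h5 h6, vi i h4 h5 h6]⟩

lemma exec_reduceOnce {K : ℕ} (hW : s 0 + 1 ≤ W) (hm : 0 < s 2) (hle : s 2 ≤ s 0)
    (hK : s 0 < 2 ^ K * s 2) (hres : s 3 + s 0 / s 2 * s 1 ≤ W) :
    ∃ (s' : ℕ → ℕ) (b : ℕ), Exec W reduceOnce s s' (K * 11 + 14) ∧ 2 ^ b * s 2 ≤ s 0 ∧
      s 0 < 2 * (2 ^ b * s 2) ∧ s' 0 = s 0 - 2 ^ b * s 2 ∧ s' 3 = s 3 + 2 ^ b * s 1 ∧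
      s' 6 = s' 0 + 1 - s 2 ∧ s' 1 = s 1 ∧ s' 2 = s 2 ∧ ∀ i, 8 ≤ i → s' i = s i := by
  have hb : ∀ b, 2 ^ b * s 2 ≤ s 0 → s 3 + 2 ^ b * s 1 ≤ W := fun b h =>
    le_trans (Nat.add_le_add_left (Nat.mul_le_mul_right _ ((Nat.le_div_iff_mul_le hm).2 h)) _) hres
  have h1 := hb 0 (by simpa using hle)
  have e1 := exec_copy (W := W) (s := s) (i := 4) (j := 1) (by norm_num) (by omega)
  set s1 := Function.update s 4 (s 1) with hs1
  have e2 := exec_copy (W := W) (s := s1) (i := 5) (j := 2) (by norm_num)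
    (by simp [hs1]; omega)
  set s2 := Function.update s1 5 (s1 2) with hs2
  have e3 := exec_testDouble (W := W) (s := s2) (by simp [hs2, hs1]; omega)
  set s3 := Function.update s2 6 (s2 0 + 1 - 2 * s2 5) with hs3
  have v0 : s3 0 = s 0 := by simp [hs3, hs2, hs1]
  have v4 : s3 4 = s 1 := by simp [hs3, hs2, hs1]
  have v5 : s3 5 = s 2 := by simp [hs3, hs2, hs1]
  have v6 : s3 6 = s 0 + 1 - 2 * s 2 := by simp [hs3, hs2, hs1]
  have vi : ∀ i, i ≠ 4 → i ≠ 5 → i ≠ 6 → s3 i = s i := by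
    intro i h4 h5 h6; simp [hs3, hs2, hs1, h4, h5, h6]
  obtain ⟨s4, b, e4, r5, r4, rle, rlt, ri⟩ := exec_scaleUp (W := W) K s3 (by omega) (by omega)
    (by omega) (by rw [v0, v5]; exact hK)
    (fun b h => by rw [v0, v5] at h; rw [v4]; have := hb b h; omega)
  rw [v5] at r5
  rw [v4] at r4
  have hbb := hb b (by omega)
  have w0 : s4 0 = s 0 := by rw [ri 0 (by norm_num) (by norm_num) (by norm_num), v0]
  have w3 : s4 3 = s 3 := by
    rw [ri 3 (by norm_num) (by norm_num) (by norm_num), vi 3 (by norm_num) (by norm_num)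
      (by norm_num)]
  have e5 := Exec.acc (W := W) true 0 5 s4 (by simp [accVal]; omega)
  set s5 := Function.update s4 0 (accVal true (s4 0) (s4 5)) with hs5
  have e6 := Exec.acc (W := W) false 3 4 s5 (by simp [accVal, hs5]; omega)
  set s6 := Function.update s5 3 (accVal false (s5 3) (s5 4)) with hs6
  have e7 := exec_testGe (W := W) (s := s6) (by simp [hs6, hs5, accVal]; omega)
  have hi : ∀ i, i ≠ 0 → i ≠ 3 → i ≠ 4 → i ≠ 5 → i ≠ 6 → s6 i = s i := by
    intro i h0 h3 h4 h5 h6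
    simp [hs6, hs5, h0, h3, ri i h4 h5 h6, vi i h4 h5 h6]
  have u2 : s6 2 = s 2 := hi 2 (by norm_num) (by norm_num) (by norm_num) (by norm_num)
    (by norm_num)
  refine ⟨_, b, ((((e1.seq e2).seq (e3.seq e4))).seq ((e5.seq e6).seq e7)).mono (by omega),
    by omega, by omega, ?_, ?_, ?_, ?_, ?_, ?_⟩
  · simp [hs6, hs5, accVal, w0, r5]
  · simp [hs6, hs5, accVal, w3, r4]
  · simp [u2]
  · simpa using hi 1 (by norm_num) (by norm_num) (by norm_num) (by norm_num) (by norm_num)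
  · simpa using u2
  · intro i h
    simpa [show i ≠ 6 by omega] using
      hi i (by omega) (by omega) (by omega) (by omega) (by omega)

/-- Binary long division. The invariant is `s 3 + s 0 / s 2 * s 1`. Subtracting the largest scaling
`2 ^ b * s 2` leaves less than `2 ^ b * s 2`, and `b ≤ k`, so every round lowers the exponent
bounding the quotient. -/
lemma exec_reduce {K : ℕ} (k : ℕ) : k ≤ K → ∀ s : ℕ → ℕ, s 0 + 1 ≤ W → 0 < s 2 →
    s 6 = s 0 + 1 - s 2 → s 0 < 2 ^ k * s 2 → s 3 + s 0 / s 2 * s 1 ≤ W →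
    ∃ s' : ℕ → ℕ, Exec W (.loop 6 reduceOnce) s s' (k * (K * 11 + 15) + 1) ∧
      s' 3 = s 3 + s 0 / s 2 * s 1 ∧ ∀ i, 8 ≤ i → s' i = s i := by
  induction k with
  | zero =>
    intro _ s hW hm h6 hk hres
    have : s 0 / s 2 = 0 := Nat.div_eq_of_lt (by omega)
    exact ⟨s, (Exec.loop_neg (by omega)).mono (by omega), by simp [this], fun i _ => rfl⟩
  | succ k ih =>
    intro hkK s hW hm h6 hk hres
    rcases Nat.lt_or_ge (s 0) (s 2) with hlt | hge
    · have : s 0 / s 2 = 0 := Nat.div_eq_of_lt (by omega)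
      exact ⟨s, (Exec.loop_neg (by omega)).mono (by omega), by simp [this], fun i _ => rfl⟩
    · obtain ⟨s1, b, e1, hb1, hb2, v0, v3, v6, v1, v2, vi⟩ := exec_reduceOnce (K := K) hW hm hge
        (hk.trans_le (Nat.mul_le_mul_right _ (Nat.pow_le_pow_right (by norm_num) hkK))) hres
      have hdiv : s 0 / s 2 = (s 0 - 2 ^ b * s 2) / s 2 + 2 ^ b := by
        rw [← Nat.add_mul_div_right _ _ hm, Nat.sub_add_cancel hb1]
      have hbk : 2 ^ b ≤ 2 ^ k := by
        have : 2 ^ b < 2 ^ (k + 1) := lt_of_mul_lt_mul_right (hb1.trans_lt hk) (Nat.zero_le _)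
        have := (Nat.pow_lt_pow_iff_right (by norm_num)).1 this
        exact Nat.pow_le_pow_right (by norm_num) (by omega)
      have hbk' := Nat.mul_le_mul_right (s 2) hbk
      have hsum : s1 3 + s1 0 / s1 2 * s1 1 = s 3 + s 0 / s 2 * s 1 := by
        rw [v3, v0, v2, v1, hdiv]; ring
      obtain ⟨s', e, r3, ri⟩ := ih (by omega) s1 (by omega) (by omega) (by rw [v6, v2])
        (by rw [v0, v2]; omega) (by rw [hsum]; exact hres)
      refine ⟨s', (Exec.loop_pos (by omega) e1 e).mono (by rw [Nat.succ_mul]; omega),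
        r3.trans hsum, fun i h => by rw [ri i h, vi i h]⟩

/-- One routine serves both operations: multiplication uses the divisor `1`, division the multiplier
`1`. Since `s 0 < W < 2 ^ W.size`, `W.size` rounds suffice. -/
lemma exec_mulDiv (hW : s 0 + 1 ≤ W) (hm : 0 < s 2) (hres : s 0 / s 2 * s 1 ≤ W) :
    ∃ s' : ℕ → ℕ, Exec W mulDiv s s' (W.size * (W.size * 11 + 15) + 5) ∧
      s' 3 = s 0 / s 2 * s 1 ∧ ∀ i, 8 ≤ i → s' i = s i := by
  have e1 := Exec.set (W := W) 3 0 s (Nat.zero_le _)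
  have e2 := exec_testGe (W := W) (s := Function.update s 3 0) (by simpa using hW)
  obtain ⟨s', e, r3, ri⟩ := exec_reduce (W := W) (K := W.size) W.size le_rfl
    (Function.update (Function.update s 3 0) 6
      (Function.update s 3 0 0 + 1 - Function.update s 3 0 2)) (by simpa using hW)
    (by simpa using hm) (by simp)
    (by
      have h1 := Nat.lt_size_self W
      have h2 := Nat.le_mul_of_pos_right (2 ^ W.size) hm
      have h3 : s 0 < 2 ^ W.size * s 2 := by omega
      simpa using h3)
    (by simpa using hres)
  refine ⟨s', ((e1.seq e2).seq e).mono (by omega), by simpa using r3, fun i h => ?_⟩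
  rw [ri i h]
  simp [show i ≠ 6 by omega, show i ≠ 3 by omega]

end Cmd

/-! ### Translating programs into commands -/

/-- Register `3` receives the result of the operation on the registers `j` and `k`. -/
def ArithOp.cmd (j k : ℕ) : ArithOp → Cmd
  | add => .seq (.copy 3 j) (.acc false 3 k)
  | sub => .seq (.copy 3 j) (.acc true 3 k)
  | mul => .seq (.seq (.copy 0 j) (.copy 1 k)) (.seq (.set 2 1) .mulDiv)
  | div => .seq (.seq (.copy 0 j) (.copy 2 k)) (.seq (.set 1 1) .mulDiv)

/-- The translation of a program; the registers are shifted by `8`. -/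
def Prog.cmd : Prog → Cmd
  | const i c => .set (i + 8) c.toNat
  | op o i j k => .seq (o.cmd (j + 8) (k + 8)) (.copy (i + 8) 3)
  | seq p q => .seq p.cmd q.cmd
  | ite i p q => .ite (i + 8) p.cmd q.cmd
  | loop i p => .loop (i + 8) p.cmd

/-- The cost of the translation of one operation, all numbers being at most `W`. -/
def opCost (W : ℕ) : ℕ := W.size * (W.size * 11 + 15) + 12

/-- The two operations missing from `opCost` pay for copying the result to its destination. -/
lemma ArithOp.exec_cmd {W : ℕ} (o : ArithOp) {j k : ℕ} (hj : 8 ≤ j) (hk : 8 ≤ k) {s : ℕ → ℕ}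
    (hsj : s j + 1 ≤ W) (hsk : s k + 1 ≤ W) (hdiv : o = div → 0 < s k)
    (h : (o.eval (s j) (s k)).toNat ≤ W) :
    ∃ s', (o.cmd j k).Exec W s s' (opCost W - 2) ∧ s' 3 = (o.eval (s j) (s k)).toNat ∧
      ∀ i, 8 ≤ i → s' i = s i := by
  have hc : opCost W - 2 = W.size * (W.size * 11 + 15) + 10 := rfl
  rw [hc]
  cases o with
  | add =>
    have e1 := Cmd.exec_copy (W := W) (s := s) (i := 3) (j := j) (by omega) (by omega)
    have hv : accVal false (Function.update s 3 (s j) 3) (Function.update s 3 (s j) k) =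
        (ArithOp.add.eval (s j) (s k)).toNat := by
      simp [accVal, show k ≠ 3 by omega, ArithOp.eval]; omega
    have e2 := Cmd.Exec.acc (W := W) false 3 k (Function.update s 3 (s j)) (hv ▸ h)
    refine ⟨_, (e1.seq e2).mono (by omega), by simpa using hv, fun i hi => ?_⟩
    simp [show i ≠ 3 by omega]
  | sub =>
    have e1 := Cmd.exec_copy (W := W) (s := s) (i := 3) (j := j) (by omega) (by omega)
    have hv : accVal true (Function.update s 3 (s j) 3) (Function.update s 3 (s j) k) =
        (ArithOp.sub.eval (s j) (s k)).toNat := by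
      simp [accVal, show k ≠ 3 by omega, ArithOp.eval]
    have e2 := Cmd.Exec.acc (W := W) true 3 k (Function.update s 3 (s j)) (hv ▸ h)
    refine ⟨_, (e1.seq e2).mono (by omega), by simpa using hv, fun i hi => ?_⟩
    simp [show i ≠ 3 by omega]
  | mul =>
    have e1 := Cmd.exec_copy (W := W) (s := s) (i := 0) (j := j) (by omega) (by omega)
    have e2 := Cmd.exec_copy (W := W) (s := Function.update s 0 (s j)) (i := 1) (j := k)
      (by omega) (by simp [show k ≠ 0 by omega]; omega)
    have e3 := Cmd.Exec.set (W := W) 2 1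
      (Function.update (Function.update s 0 (s j)) 1 (Function.update s 0 (s j) k)) (by omega)
    have hv : s j * s k = (ArithOp.mul.eval (s j) (s k)).toNat := by
      simp only [ArithOp.eval]; exact_mod_cast rfl
    obtain ⟨s', e4, r3, ri⟩ := Cmd.exec_mulDiv (W := W) (s := Function.update (Function.update
      (Function.update s 0 (s j)) 1 (Function.update s 0 (s j) k)) 2 1)
      (by simpa using hsj) (by simp) (by simpa [show k ≠ 0 by omega, hv] using h)
    refine ⟨s', ((e1.seq e2).seq (e3.seq e4)).mono (by omega), ?_, fun i hi => ?_⟩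
    · rw [r3, ← hv]; simp [show k ≠ 0 by omega]
    · rw [ri i hi]
      simp [show i ≠ 0 by omega, show i ≠ 1 by omega, show i ≠ 2 by omega]
  | div =>
    have e1 := Cmd.exec_copy (W := W) (s := s) (i := 0) (j := j) (by omega) (by omega)
    have e2 := Cmd.exec_copy (W := W) (s := Function.update s 0 (s j)) (i := 2) (j := k)
      (by omega) (by simp [show k ≠ 0 by omega]; omega)
    have e3 := Cmd.Exec.set (W := W) 1 1
      (Function.update (Function.update s 0 (s j)) 2 (Function.update s 0 (s j) k)) (by omega)
    have hv : s j / s k = (ArithOp.div.eval (s j) (s k)).toNat := by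
      simp only [ArithOp.eval]; exact_mod_cast rfl
    obtain ⟨s', e4, r3, ri⟩ := Cmd.exec_mulDiv (W := W) (s := Function.update (Function.update
      (Function.update s 0 (s j)) 2 (Function.update s 0 (s j) k)) 1 1)
      (by simpa using hsj) (by simpa [show k ≠ 0 by omega] using hdiv rfl)
      (by simpa [show k ≠ 0 by omega, hv] using h)
    refine ⟨s', ((e1.seq e2).seq (e3.seq e4)).mono (by omega), ?_, fun i hi => ?_⟩
    · rw [r3, ← hv]; simp [show k ≠ 0 by omega]
    · rw [ri i hi]
      simp [show i ≠ 0 by omega, show i ≠ 1 by omega, show i ≠ 2 by omega]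

/-- The registers `S` of a command, shifted by `8`, hold the positive parts of the registers `s` of
a program. -/
def Represents (s : ℕ → ℤ) (S : ℕ → ℕ) : Prop := ∀ i, S (i + 8) = (s i).toNat

lemma Represents.update {s : ℕ → ℤ} {S : ℕ → ℕ} (h : Represents s S) (i : ℕ) (c : ℤ) :
    Represents (Function.update s i c) (Function.update S (i + 8) c.toNat) := by
  intro k
  rcases eq_or_ne k i with rfl | hk
  · simp
  · simp [hk, h k]

/-- Positive parts suffice: tests only separate positive from nonpositive values, operands are
nonnegative, and truncated subtraction computes the positive part of a difference. The bound `W + 1`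
leaves room for the `+ 1` in the comparisons of `mulDiv`. -/
theorem Prog.Bounded.exec_cmd {W : ℕ} {p : Prog} {s s' : ℕ → ℤ} {n : ℕ}
    (h : p.Bounded W s s' n) : ∀ S : ℕ → ℕ, (∀ i, s i ≤ W) → Represents s S →
    ∃ S', p.cmd.Exec (W + 1) S S' (n * opCost (W + 1)) ∧ Represents s' S' := by
  have hC : 12 ≤ opCost (W + 1) := Nat.le_add_left _ _
  induction h with
  | const i c s h =>
    intro S _ hS
    exact ⟨_, (Cmd.Exec.set _ _ _ (by omega)).mono (by omega), hS.update i c⟩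
  | op o i j k s hj hk hdiv h =>
    intro S hs hS
    have vj : ((S (j + 8) : ℕ) : ℤ) = s j := by rw [hS]; omega
    have vk : ((S (k + 8) : ℕ) : ℤ) = s k := by rw [hS]; omega
    have := hs j
    have := hs k
    obtain ⟨S', e, r3, ri⟩ := o.exec_cmd (W := W + 1) (s := S) (j := j + 8) (k := k + 8)
      (by omega) (by omega) (by omega) (by omega) (fun ho => by have := hdiv ho; omega)
      (by rw [vj, vk]; omega)
    rw [vj, vk] at r3
    have e2 := Cmd.exec_copy (W := W + 1) (s := S') (i := i + 8) (j := 3) (by omega) (by omega)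
    refine ⟨_, (e.seq e2).mono (by omega), ?_⟩
    rw [r3]
    exact Represents.update (fun m => by rw [ri _ (by omega), hS m]) i _
  | seq h₁ h₂ ih₁ ih₂ =>
    intro S hs hS
    obtain ⟨S₁, e₁, hS₁⟩ := ih₁ S hs hS
    obtain ⟨S₂, e₂, hS₂⟩ := ih₂ S₁ (h₁.le hs) hS₁
    exact ⟨S₂, (e₁.seq e₂).mono (by rw [add_mul]), hS₂⟩
  | @ite_pos i p q s s' n h h₁ ih =>
    intro S hs hS
    obtain ⟨S₁, e₁, hS₁⟩ := ih S hs hS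
    have := hS i
    exact ⟨S₁, (Cmd.Exec.ite_pos (by omega) e₁).mono (by rw [add_mul]; omega), hS₁⟩
  | @ite_neg i p q s s' n h h₁ ih =>
    intro S hs hS
    obtain ⟨S₁, e₁, hS₁⟩ := ih S hs hS
    have := hS i
    exact ⟨S₁, (Cmd.Exec.ite_neg (by omega) e₁).mono (by rw [add_mul]; omega), hS₁⟩
  | @loop_pos i p s s' s'' m n h h₁ h₂ ih₁ ih₂ =>
    intro S hs hS
    obtain ⟨S₁, e₁, hS₁⟩ := ih₁ S hs hS
    obtain ⟨S₂, e₂, hS₂⟩ := ih₂ S₁ (h₁.le hs) hS₁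
    have := hS i
    exact ⟨S₂, (Cmd.Exec.loop_pos (by omega) e₁ e₂).mono (by rw [add_mul, add_mul]; omega), hS₂⟩
  | @loop_neg i p s h =>
    intro S hs hS
    have := hS i
    exact ⟨S, (Cmd.Exec.loop_neg (by omega)).mono (by omega), hS⟩

/-! ### The program evaluating the closed formula -/

/-- Multiply register `7` by the next factor of the binomial coefficient. -/
def chooseStep : Prog :=
  .seq (.seq (.op .add 9 9 3) (.op .add 8 8 3))
    (.seq (.seq (.op .mul 7 7 8) (.op .div 7 7 9)) (.op .sub 10 10 3))

/-- Register `8` becomes `⌈a / l⌉ - 1`, where `a` is in register `4`. -/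
def ceilStep : Prog :=
  .seq (.seq (.op .add 8 4 0) (.op .sub 8 8 3)) (.seq (.op .div 8 8 0) (.op .sub 8 8 3))

/-- Initialize the computation of the next binomial coefficient. -/
def chooseInit : Prog :=
  .seq (.seq (.op .add 5 5 3) (.const 7 1))
    (.seq (.const 9 0) (.seq (.const 10 0) (.op .add 10 10 5)))

/-- Add the next binomial coefficient to register `6`. -/
def sumStep : Prog :=
  .seq (.seq chooseInit ceilStep)
    (.seq (.loop 10 chooseStep) (.seq (.op .add 6 6 7) (.op .sub 4 4 1)))

/-- Evaluate the closed formula, given `l`, `r`, `G` in the registers `0`, `1`, `2`. -/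
def formulaProg : Prog :=
  .seq (.seq (.seq (.const 3 1) (.const 4 0))
      (.seq (.op .add 4 4 2) (.seq (.const 5 0) (.const 6 0))))
    (.seq (.loop 4 sumStep) (.seq (.op .add 0 6 6) (.op .add 0 0 3)))

/-- By `(M + 1) C(M, i) = (i + 1) C(M + 1, i + 1)`, multiplying first makes the division exact; `hW`
bounds the intermediate product. -/
lemma bounded_chooseStep {W M i c : ℕ} {s : ℕ → ℤ} (h3 : s 3 = 1) (h7 : s 7 = (M.choose i : ℕ))
    (h8 : s 8 = M) (h9 : s 9 = i) (h10 : s 10 = (c + 1 : ℕ)) (hW : M.choose i * (M + 1) ≤ W)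
    (hM : M + 1 ≤ W) (hi : i + 1 ≤ W) (hc : c ≤ W) :
    ∃ s', chooseStep.Bounded W s s' 5 ∧ s' 7 = ((M + 1).choose (i + 1) : ℕ) ∧
      s' 8 = (M + 1 : ℕ) ∧ s' 9 = (i + 1 : ℕ) ∧ s' 10 = c ∧
      ∀ k, k < 7 ∨ 11 ≤ k → s' k = s k := by
  have hchoose : M.choose i * (M + 1) = (M + 1).choose (i + 1) * (i + 1) := by
    rw [mul_comm, Nat.add_one_mul_choose_eq]
  have hdiv : ((M.choose i * (M + 1) : ℕ) : ℤ) / ((i + 1 : ℕ) : ℤ) =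
      ((M + 1).choose (i + 1) : ℕ) := by
    rw [hchoose]; push_cast
    exact Int.mul_ediv_cancel _ (by positivity)
  have hle : (M + 1).choose (i + 1) ≤ W :=
    le_trans (Nat.le_mul_of_pos_right _ (Nat.succ_pos i)) (hchoose ▸ hW)
  have e1 := Prog.Bounded.op (W := W) .add 9 9 3 s (by omega) (by omega) (by simp)
    (by simp only [ArithOp.eval]; omega)
  rw [show ArithOp.add.eval (s 9) (s 3) = (i + 1 : ℕ) by simp [ArithOp.eval, h9, h3]] at e1
  set s1 := Function.update s 9 ((i + 1 : ℕ) : ℤ) with hs1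
  have v3 : s1 3 = 1 := by simp [hs1, h3]
  have v8 : s1 8 = M := by simp [hs1, h8]
  have e2 := Prog.Bounded.op (W := W) .add 8 8 3 s1 (by omega) (by omega) (by simp)
    (by simp only [ArithOp.eval]; omega)
  rw [show ArithOp.add.eval (s1 8) (s1 3) = (M + 1 : ℕ) by simp [ArithOp.eval, v8, v3]] at e2
  set s2 := Function.update s1 8 ((M + 1 : ℕ) : ℤ) with hs2
  have v7 : s2 7 = (M.choose i : ℕ) := by simp [hs2, hs1, h7]
  have v8 : s2 8 = (M + 1 : ℕ) := by simp [hs2]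
  have hmul : ArithOp.mul.eval (s2 7) (s2 8) = ((M.choose i * (M + 1) : ℕ) : ℤ) := by
    simp [ArithOp.eval, v7, v8]
  have e3 := Prog.Bounded.op (W := W) .mul 7 7 8 s2 (by omega) (by omega) (by simp)
    (by rw [hmul]; exact_mod_cast hW)
  rw [hmul] at e3
  set s3 := Function.update s2 7 ((M.choose i * (M + 1) : ℕ) : ℤ) with hs3
  have v7 : s3 7 = ((M.choose i * (M + 1) : ℕ) : ℤ) := by simp [hs3]
  have v9 : s3 9 = (i + 1 : ℕ) := by simp [hs3, hs2, hs1]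
  have hdiv' : ArithOp.div.eval (s3 7) (s3 9) = ((M + 1).choose (i + 1) : ℕ) := by
    rw [v7, v9]; exact hdiv
  have e4 := Prog.Bounded.op (W := W) .div 7 7 9 s3 (by rw [v7]; positivity) (by omega)
    (fun _ => by omega) (by rw [hdiv']; exact_mod_cast hle)
  rw [hdiv'] at e4
  set s4 := Function.update s3 7 (((M + 1).choose (i + 1) : ℕ) : ℤ) with hs4
  have v3 : s4 3 = 1 := by simp [hs4, hs3, hs2, hs1, h3]
  have v10 : s4 10 = (c + 1 : ℕ) := by simp [hs4, hs3, hs2, hs1, h10]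
  have hsub : ArithOp.sub.eval (s4 10) (s4 3) = c := by simp [ArithOp.eval, v10, v3]
  have e5 := Prog.Bounded.op (W := W) .sub 10 10 3 s4 (by omega) (by omega) (by simp)
    (by rw [hsub]; exact_mod_cast hc)
  rw [hsub] at e5
  refine ⟨_, (e1.seq e2).seq ((e3.seq e4).seq e5), ?_, ?_, ?_, ?_, ?_⟩
  · simp [hs4]
  · simp [hs4, hs3, hs2]
  · simp [hs4, hs3, hs2, hs1]
  · simp
  · intro k hk
    simp [hs4, hs3, hs2, hs1, show k ≠ 7 by omega, show k ≠ 8 by omega, show k ≠ 9 by omega,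
      show k ≠ 10 by omega]

/-- `X` bounds the upper and `D` the lower arguments, so the products stay below `X ^ i * X ≤ X ^
D`. A round costs five operations and one comparison. -/
lemma bounded_chooseLoop {W X D : ℕ} (hX : 0 < X) (hXD : X ^ D ≤ W) (hXW : X ≤ W) (hDX : D ≤ X)
    (c : ℕ) : ∀ (M i : ℕ) (s : ℕ → ℤ), s 3 = 1 → s 7 = (M.choose i : ℕ) → s 8 = M → s 9 = i →
      s 10 = c → M + c ≤ X → i + c ≤ D →
    ∃ s', (Prog.loop 10 chooseStep).Bounded W s s' (6 * c + 1) ∧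
      s' 7 = ((M + c).choose (i + c) : ℕ) ∧ ∀ k, k < 7 ∨ 11 ≤ k → s' k = s k := by
  induction c with
  | zero =>
    intro M i s h3 h7 h8 h9 h10 hM hi
    exact ⟨s, .loop_neg (by simp [h10]), h7, fun _ _ => rfl⟩
  | succ c ih =>
    intro M i s h3 h7 h8 h9 h10 hM hi
    have hb : M.choose i * (M + 1) ≤ W := by
      refine le_trans ?_ hXD
      calc M.choose i * (M + 1) ≤ X ^ i * X :=
            Nat.mul_le_mul ((Nat.choose_le_pow _ _).trans (Nat.pow_le_pow_left (by omega) _))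
              (by omega)
        _ = X ^ (i + 1) := (pow_succ _ _).symm
        _ ≤ X ^ D := Nat.pow_le_pow_right hX (by omega)
    obtain ⟨s1, e1, r7, r8, r9, r10, ri⟩ := bounded_chooseStep h3 h7 h8 h9 h10 hb (by omega)
      (by omega) (by omega)
    obtain ⟨s2, e2, q7, qi⟩ := ih (M + 1) (i + 1) s1 (by rw [ri 3 (by norm_num), h3]) r7 r8 r9 r10
      (by omega) (by omega)
    refine ⟨s2, ?_, ?_, fun k hk => by rw [qi k hk, ri k hk]⟩
    · have := Prog.Bounded.loop_pos (i := 10) (by rw [h10]; positivity) e1 e2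
      rwa [show 5 + (6 * c + 1) + 1 = 6 * (c + 1) + 1 by ring] at this
    · rw [q7]; congr 2 <;> ring

lemma bounded_chooseInit {W k : ℕ} {s : ℕ → ℤ} (h3 : s 3 = 1) (h5 : s 5 = k) (hk : k + 1 ≤ W) :
    ∃ s', chooseInit.Bounded W s s' 5 ∧ s' 5 = (k + 1 : ℕ) ∧ s' 7 = 1 ∧ s' 9 = 0 ∧
      s' 10 = (k + 1 : ℕ) ∧ ∀ i, i ≠ 5 → i ≠ 7 → i ≠ 9 → i ≠ 10 → s' i = s i := by
  have e1 := Prog.Bounded.op (W := W) .add 5 5 3 s (by omega) (by omega) (by simp)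
    (by simp only [ArithOp.eval]; omega)
  rw [show ArithOp.add.eval (s 5) (s 3) = (k + 1 : ℕ) by simp [ArithOp.eval, h5, h3]] at e1
  have e2 := Prog.Bounded.const (W := W) 7 1 (Function.update s 5 ((k + 1 : ℕ) : ℤ)) (by omega)
  set s2 := Function.update (Function.update s 5 ((k + 1 : ℕ) : ℤ)) 7 1 with hs2
  have e3 := Prog.Bounded.const (W := W) 9 0 s2 (by omega)
  have e4 := Prog.Bounded.const (W := W) 10 0 (Function.update s2 9 0) (by omega)
  set s4 := Function.update (Function.update s2 9 0) 10 0 with hs4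
  have v5 : s4 5 = (k + 1 : ℕ) := by simp [hs4, hs2]
  have v10 : s4 10 = 0 := by simp [hs4]
  have hadd : ArithOp.add.eval (s4 10) (s4 5) = (k + 1 : ℕ) := by simp [ArithOp.eval, v5, v10]
  have e5 := Prog.Bounded.op (W := W) .add 10 10 5 s4 (by omega) (by omega) (by simp)
    (by rw [hadd]; exact_mod_cast hk)
  rw [hadd] at e5
  refine ⟨_, (e1.seq e2).seq (e3.seq (e4.seq e5)), ?_, ?_, ?_, ?_, fun i h5 h7 h9 h10 => ?_⟩
  · simp [hs4, hs2]
  · simp [hs4, hs2]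
  · simp [hs4]
  · simp
  · simp [hs4, hs2, h5, h7, h9, h10]

lemma bounded_ceilStep {W a l : ℕ} {s : ℕ → ℤ} (h0 : s 0 = l) (h3 : s 3 = 1) (h4 : s 4 = a)
    (hl : 0 < l) (ha : 0 < a) (hW : a + l ≤ W) :
    ∃ s', ceilStep.Bounded W s s' 4 ∧ s' 8 = (cdiv a l - 1 : ℕ) ∧
      ∀ i, i ≠ 8 → s' i = s i := by
  have hd : cdiv a l ≤ a := cdiv_le_self hl
  have hd0 : 0 < cdiv a l := cdiv_pos hl ha
  have e1 := Prog.Bounded.op (W := W) .add 8 4 0 s (by omega) (by omega) (by simp)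
    (by simp only [ArithOp.eval]; omega)
  rw [show ArithOp.add.eval (s 4) (s 0) = (a + l : ℕ) by simp [ArithOp.eval, h4, h0]] at e1
  set s1 := Function.update s 8 ((a + l : ℕ) : ℤ) with hs1
  have v8 : s1 8 = (a + l : ℕ) := by simp [hs1]
  have v3 : s1 3 = 1 := by simp [hs1, h3]
  have hsub : ArithOp.sub.eval (s1 8) (s1 3) = (a + (l - 1) : ℕ) := by
    simp only [ArithOp.eval, v8, v3]; omega
  have e2 := Prog.Bounded.op (W := W) .sub 8 8 3 s1 (by omega) (by omega) (by simp)
    (by rw [hsub]; omega)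
  rw [hsub] at e2
  set s2 := Function.update s1 8 ((a + (l - 1) : ℕ) : ℤ) with hs2
  have v8 : s2 8 = (a + (l - 1) : ℕ) := by simp [hs2]
  have v0 : s2 0 = l := by simp [hs2, hs1, h0]
  have hdiv : ArithOp.div.eval (s2 8) (s2 0) = (cdiv a l : ℕ) := by
    simp only [ArithOp.eval, v8, v0, cdiv]; exact_mod_cast rfl
  have e3 := Prog.Bounded.op (W := W) .div 8 8 0 s2 (by omega) (by omega) (fun _ => by omega)
    (by rw [hdiv]; omega)
  rw [hdiv] at e3
  set s3 := Function.update s2 8 ((cdiv a l : ℕ) : ℤ) with hs3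
  have v8 : s3 8 = (cdiv a l : ℕ) := by simp [hs3]
  have v3 : s3 3 = 1 := by simp [hs3, hs2, hs1, h3]
  have hsub : ArithOp.sub.eval (s3 8) (s3 3) = (cdiv a l - 1 : ℕ) := by
    simp only [ArithOp.eval, v8, v3]; omega
  have e4 := Prog.Bounded.op (W := W) .sub 8 8 3 s3 (by omega) (by omega) (by simp)
    (by rw [hsub]; omega)
  rw [hsub] at e4
  refine ⟨_, (e1.seq e2).seq (e3.seq e4), by simp, fun i hi => ?_⟩
  simp [hs3, hs2, hs1, hi]

variable {l r G W : ℕ}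

/-- The numbers occurring in the evaluation of the formula, except products, are at most this. -/
def valueBound (r G : ℕ) : ℕ := 2 * (G + r)

lemma levelCount_le (hl : 0 < l) {k : ℕ} (hk : k * r < G) :
    levelCount l r G k ≤ (k + G) ^ (k + 1) := by
  refine (Nat.choose_le_pow _ _).trans (Nat.pow_le_pow_left ?_ _)
  have := cdiv_le_self (a := G - k * r) hl
  omega

lemma bounded_sumStep {k S : ℕ} {s : ℕ → ℤ} (hl : 0 < l) (hlr : l ≤ r) (hk : k * r < G)
    (hW : valueBound r G ^ cdiv G r ≤ W) (hS : S + levelCount l r G k ≤ W) (h0 : s 0 = l)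
    (h1 : s 1 = r) (h3 : s 3 = 1) (h4 : s 4 = (G : ℤ) - k * r) (h5 : s 5 = k) (h6 : s 6 = S) :
    ∃ s', sumStep.Bounded W s s' (6 * k + 18) ∧ s' 4 = (G : ℤ) - (k + 1 : ℕ) * r ∧
      s' 5 = (k + 1 : ℕ) ∧ s' 6 = (S + levelCount l r G k : ℕ) ∧
      ∀ i, i < 4 ∨ 11 ≤ i → s' i = s i := by
  have hr : 0 < r := hl.trans_le hlr
  have hkG : k < G := lt_of_le_of_lt (Nat.le_mul_of_pos_right k hr) hk
  have hkd : k < cdiv G r := by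
    by_contra h
    exact absurd ((cdiv_le_iff hr).1 (not_lt.1 h)) (by omega)
  have hdG : cdiv G r ≤ G := cdiv_le_self hr
  have hX : valueBound r G ≤ W :=
    le_trans (Nat.le_self_pow (by omega) _) hW
  have hXdef : valueBound r G = 2 * (G + r) := rfl
  set a := G - k * r with ha
  have h4' : s 4 = a := by rw [h4, ha, Nat.cast_sub hk.le]; push_cast; ring
  have hca : cdiv a l ≤ a := cdiv_le_self hl
  have hca0 : 0 < cdiv a l := cdiv_pos hl (by omega)
  obtain ⟨s1, e1, r5, r7, r9, r10, ri⟩ := bounded_chooseInit (W := W) h3 h5 (by omega)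
  obtain ⟨s2, e2, q8, qi⟩ := bounded_ceilStep (W := W) (s := s1) (a := a) (l := l)
    (by rw [ri 0 (by norm_num) (by norm_num) (by norm_num) (by norm_num), h0])
    (by rw [ri 3 (by norm_num) (by norm_num) (by norm_num) (by norm_num), h3])
    (by rw [ri 4 (by norm_num) (by norm_num) (by norm_num) (by norm_num), h4'])
    hl (by omega) (by omega)
  have w : ∀ i, i ≠ 5 → i ≠ 7 → i ≠ 9 → i ≠ 10 → i ≠ 8 → s2 i = s i :=
    fun i h5 h7 h9 h10 h8 => by rw [qi i h8, ri i h5 h7 h9 h10]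
  -- With `m = ⌈(G - k r)/l⌉`, the coefficient climbs from `C(m - 1, 0) = 1` to `C(m + k, k + 1)` in
  -- `k + 1` rounds.
  obtain ⟨s3, e3, p7, pi⟩ := bounded_chooseLoop (W := W) (X := valueBound r G) (D := cdiv G r)
    (by omega) hW hX (by omega) (k + 1) (cdiv a l - 1) 0 s2
    (by rw [w 3 (by norm_num) (by norm_num) (by norm_num) (by norm_num) (by norm_num), h3])
    (by rw [qi 7 (by norm_num), r7]; simp) q8
    (by rw [qi 9 (by norm_num), r9]; simp) (by rw [qi 10 (by norm_num), r10])
    (by omega) (by omega)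
  have p7 : s3 7 = (levelCount l r G k : ℕ) := by
    rw [p7, levelCount, ← ha]; congr 2 <;> omega
  have u4 : s3 4 = a := by
    rw [pi 4 (by norm_num), w 4 (by norm_num) (by norm_num) (by norm_num) (by norm_num)
      (by norm_num), h4']
  have u1 : s3 1 = r := by
    rw [pi 1 (by norm_num), w 1 (by norm_num) (by norm_num) (by norm_num) (by norm_num)
      (by norm_num), h1]
  have u5 : s3 5 = (k + 1 : ℕ) := by rw [pi 5 (by norm_num), qi 5 (by norm_num), r5]
  have u6 : s3 6 = S := by
    rw [pi 6 (by norm_num), w 6 (by norm_num) (by norm_num) (by norm_num) (by norm_num)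
      (by norm_num), h6]
  have hadd : ArithOp.add.eval (s3 6) (s3 7) = (S + levelCount l r G k : ℕ) := by
    simp [ArithOp.eval, u6, p7]
  have e4 := Prog.Bounded.op (W := W) .add 6 6 7 s3 (by omega) (by omega) (by simp)
    (by rw [hadd]; exact_mod_cast hS)
  rw [hadd] at e4
  set s4 := Function.update s3 6 ((S + levelCount l r G k : ℕ) : ℤ) with hs4
  have u4' : s4 4 = a := by simp [hs4, u4]
  have u1' : s4 1 = r := by simp [hs4, u1]
  have hsub : ArithOp.sub.eval (s4 4) (s4 1) = (G : ℤ) - (k + 1 : ℕ) * r := by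
    simp only [ArithOp.eval, u4', u1', ha, Nat.cast_sub hk.le]; push_cast; ring
  have e5 := Prog.Bounded.op (W := W) .sub 4 4 1 s4 (by omega) (by omega) (by simp)
    (by simp only [ArithOp.eval]; omega)
  rw [hsub] at e5
  have e := (e1.seq e2).seq (e3.seq (e4.seq e5))
  rw [show 5 + 4 + (6 * (k + 1) + 1 + (1 + 1)) = 6 * k + 18 by ring] at e
  refine ⟨_, e, ?_, ?_, ?_, fun i hi => ?_⟩
  · simp
  · simp [hs4, u5]
  · simp [hs4]
  · simp [hs4, show i ≠ 4 by omega, show i ≠ 6 by omega]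
    rw [pi i (by omega), w i (by omega) (by omega) (by omega) (by omega) (by omega)]

/-- Register `4` holds `G - k r`, which is positive exactly for `k < ⌈G/r⌉`, so the depth is never
computed. Round `k` costs `6 k + 19 ≤ 6 ⌈G/r⌉ + 13`. -/
lemma bounded_sumLoop (hl : 0 < l) (hlr : l ≤ r) (hW : valueBound r G ^ cdiv G r ≤ W)
    (hS : ∑ k ∈ Finset.range (cdiv G r), levelCount l r G k ≤ W) (m : ℕ) :
    ∀ (k : ℕ) (s : ℕ → ℤ), k + m = cdiv G r → s 0 = l → s 1 = r → s 3 = 1 →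
      s 4 = (G : ℤ) - k * r → s 5 = k →
      s 6 = (∑ j ∈ Finset.range k, levelCount l r G j : ℕ) →
    ∃ s' n, (Prog.loop 4 sumStep).Bounded W s s' n ∧ n ≤ m * (6 * cdiv G r + 13) + 1 ∧
      s' 6 = (∑ j ∈ Finset.range (cdiv G r), levelCount l r G j : ℕ) ∧
      ∀ i, i < 4 ∨ 11 ≤ i → s' i = s i := by
  have hr : 0 < r := hl.trans_le hlr
  induction m with
  | zero =>
    intro k s hk h0 h1 h3 h4 h5 h6
    have hle : G ≤ k * r := (cdiv_le_iff hr).1 (by omega)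
    have : (G : ℤ) ≤ k * r := by exact_mod_cast hle
    refine ⟨s, 1, .loop_neg (by omega), by omega, by rw [h6, ← hk, add_zero], fun _ _ => rfl⟩
  | succ m ih =>
    intro k s hk h0 h1 h3 h4 h5 h6
    have hlt : k * r < G := by
      by_contra h
      exact absurd ((cdiv_le_iff hr).2 (not_lt.1 h)) (by omega)
    have : (k * r : ℤ) < G := by exact_mod_cast hlt
    have hsum : ∑ j ∈ Finset.range k, levelCount l r G j + levelCount l r G k =
        ∑ j ∈ Finset.range (k + 1), levelCount l r G j := (Finset.sum_range_succ _ _).symm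
    obtain ⟨s1, e1, r4, r5, r6, ri⟩ := bounded_sumStep hl hlr hlt hW
      (by
        rw [hsum]
        exact le_trans (Finset.sum_le_sum_of_subset (Finset.range_mono (by omega))) hS)
      h0 h1 h3 h4 h5 h6
    rw [hsum] at r6
    obtain ⟨s2, n, e2, hn, q6, qi⟩ := ih (k + 1) s1 (by omega) (by rw [ri 0 (by norm_num), h0])
      (by rw [ri 1 (by norm_num), h1]) (by rw [ri 3 (by norm_num), h3]) r4 r5 r6
    refine ⟨s2, _, .loop_pos (by omega) e1 e2, ?_, q6, fun i hi => by rw [qi i hi, ri i hi]⟩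
    rw [add_mul, one_mul]; omega

/-- The clause on registers from `11` on protects `k` and the answer when the deciding program calls
the evaluation. -/
theorem bounded_formulaProg (x : BranchVar) {G W : ℕ} {s : ℕ → ℤ}
    (hW : valueBound x.r G ^ cdiv G x.r ≤ W) (hF : closedForm x G ≤ W) (hG : G ≤ W)
    (h0 : s 0 = x.l) (h1 : s 1 = x.r) (h2 : s 2 = G) :
    ∃ s' n, formulaProg.Bounded W s s' n ∧ n ≤ cdiv G x.r * (6 * cdiv G x.r + 13) + 8 ∧
      s' 0 = closedForm x G ∧ ∀ i, 11 ≤ i → s' i = s i := by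
  have hcf := closedForm_eq_depth_sum x G
  have e1 := Prog.Bounded.const (W := W) 3 1 s (by omega)
  have e2 := Prog.Bounded.const (W := W) 4 0 (Function.update s 3 1) (by omega)
  set s2 := Function.update (Function.update s 3 1) 4 0 with hs2
  have v4 : s2 4 = 0 := by simp [hs2]
  have v2 : s2 2 = G := by simp [hs2, h2]
  have e3 := Prog.Bounded.op (W := W) .add 4 4 2 s2 (by omega) (by omega) (by simp)
    (by simp only [ArithOp.eval]; omega)
  rw [show ArithOp.add.eval (s2 4) (s2 2) = G by simp [ArithOp.eval, v4, v2]] at e3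
  set s3 := Function.update s2 4 (G : ℤ) with hs3
  have e4 := Prog.Bounded.const (W := W) 5 0 s3 (by omega)
  have e5 := Prog.Bounded.const (W := W) 6 0 (Function.update s3 5 0) (by omega)
  set s5 := Function.update (Function.update s3 5 0) 6 0 with hs5
  obtain ⟨s6, n, e6, hn, r6, ri⟩ := bounded_sumLoop (W := W) (l := x.l) (r := x.r) (G := G)
    x.l_pos x.l_le_r hW (by omega) (cdiv G x.r) 0 s5 (by omega)
    (by simp [hs5, hs3, hs2, h0]) (by simp [hs5, hs3, hs2, h1]) (by simp [hs5, hs3, hs2])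
    (by simp [hs5, hs3]) (by simp [hs5]) (by simp [hs5])
  set S := ∑ k ∈ Finset.range (cdiv G x.r), levelCount x.l x.r G k with hSdef
  have e7 := Prog.Bounded.op (W := W) .add 0 6 6 s6 (by omega) (by omega) (by simp)
    (by simp only [ArithOp.eval]; omega)
  rw [show ArithOp.add.eval (s6 6) (s6 6) = (2 * S : ℕ) by
    simp only [ArithOp.eval, r6]; push_cast; ring] at e7
  set s7 := Function.update s6 0 ((2 * S : ℕ) : ℤ) with hs7
  have w0 : s7 0 = (2 * S : ℕ) := by simp [hs7]
  have w3 : s7 3 = 1 := by simp [hs7, ri 3, hs5, hs3, hs2]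
  have hadd : ArithOp.add.eval (s7 0) (s7 3) = closedForm x G := by
    simp only [ArithOp.eval, w0, w3, hcf]; push_cast; ring
  have e8 := Prog.Bounded.op (W := W) .add 0 0 3 s7 (by omega) (by omega) (by simp)
    (by rw [hadd]; exact_mod_cast hF)
  rw [hadd] at e8
  refine ⟨_, _, ((e1.seq e2).seq (e3.seq (e4.seq e5))).seq (e6.seq (e7.seq e8)), by omega,
    by simp, fun i hi => ?_⟩
  simp [hs7, show i ≠ 0 by omega]
  rw [ri i (by omega)]
  simp [hs5, hs3, hs2, show i ≠ 3 by omega, show i ≠ 4 by omega, show i ≠ 5 by omega,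
    show i ≠ 6 by omega]

/-! ### The program deciding the problem -/

/-- Register `17` becomes positive if and only if register `i` is at most register `j`. -/
def leTest (i j : ℕ) : Prog := .seq (.op .add 17 j 3) (.op .sub 17 17 i)

/-- Double register `14`, subtract `r` from register `15`; register `16` becomes positive if and
only if register `15` is positive and register `14` is at most register `11`. -/
def growStep : Prog :=
  .seq (.seq (.op .add 14 14 14) (.op .sub 15 15 1))
    (.seq (.const 16 0) (.ite 15 (.seq (.op .add 16 11 3) (.op .sub 16 16 14)) (.const 17 0)))

/-- Set register `13` to `1` if the closed formula is at most register `11`. -/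
def compareFormula : Prog :=
  .seq (.seq formulaProg (.const 3 1)) (.seq (leTest 0 11) (.ite 17 (.const 13 1) (.const 17 0)))

/-- Decide a valid instance: evaluate the formula unless the depth of the tree is too large. -/
def decideValid : Prog :=
  .seq (.seq (.seq (.const 14 1) (.const 15 0)) (.seq (.op .add 15 15 2) (.const 16 1)))
    (.seq (.loop 16 growStep) (.ite 15 (.const 17 0) compareFormula))

/-- Decide an instance: `l`, `r`, `G`, `k` are given in the registers `0`, `1`, `2`, `11`, and
register `12` is positive if the instance is malformed. Register `13` receives the answer. -/
def decideProg : Prog :=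
  .seq (.seq (.const 13 0) (.const 3 1)) <| .ite 12 (.const 17 0) <| .ite 0
    (.seq (leTest 0 1) <| .ite 17
      (.seq (leTest 1 2) <| .ite 17 (.ite 11 decideValid (.const 17 0)) (.const 17 0))
      (.const 17 0))
    (.const 17 0)

lemma bounded_leTest {W i j a b : ℕ} {s : ℕ → ℤ} (hi : i ≠ 17) (h3 : s 3 = 1) (ha : s i = a)
    (hb : s j = b) (hW : b + 1 ≤ W) :
    (leTest i j).Bounded W s (Function.update s 17 ((b : ℤ) + 1 - a)) 2 := by
  have e1 := Prog.Bounded.op (W := W) .add 17 j 3 s (by omega) (by omega) (by simp)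
    (by simp only [ArithOp.eval]; omega)
  have e2 := Prog.Bounded.op (W := W) .sub 17 17 i
    (Function.update s 17 (ArithOp.add.eval (s j) (s 3))) (by simp [ArithOp.eval]; omega)
    (by simp [hi, ha]) (by simp) (by simp [ArithOp.eval, hi]; omega)
  have e := e1.seq e2
  simpa [leTest, ArithOp.eval, hi, h3, ha, hb] using e

lemma bounded_growStep {W t r G k : ℕ} {s : ℕ → ℤ} (h1 : s 1 = r) (h3 : s 3 = 1) (h11 : s 11 = k)
    (h14 : s 14 = (2 ^ t : ℕ)) (h15 : s 15 = (G : ℤ) - t * r) (htG : t * r < G) (htk : 2 ^ t ≤ k)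
    (hG : G ≤ W) (hk : 2 * k ≤ W) :
    ∃ s' n, growStep.Bounded W s s' n ∧ n ≤ 6 ∧ s' 14 = (2 ^ (t + 1) : ℕ) ∧
      s' 15 = (G : ℤ) - (t + 1 : ℕ) * r ∧
      (0 < s' 16 ↔ (t + 1) * r < G ∧ 2 ^ (t + 1) ≤ k) ∧
      ∀ i, i < 14 ∨ 18 ≤ i → s' i = s i := by
  have htG' : (t * r : ℤ) < G := by exact_mod_cast htG
  have hpow : 2 ^ (t + 1) = 2 * 2 ^ t := pow_succ' 2 t
  have hk1 : 1 ≤ k := Nat.one_le_two_pow.trans htk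
  have hadd : ArithOp.add.eval (s 14) (s 14) = (2 ^ (t + 1) : ℕ) := by
    simp only [ArithOp.eval]; omega
  have e1 := Prog.Bounded.op (W := W) .add 14 14 14 s (by omega) (by omega) (by simp)
    (by rw [hadd]; omega)
  rw [hadd] at e1
  set s1 := Function.update s 14 ((2 ^ (t + 1) : ℕ) : ℤ) with hs1
  have v15 : s1 15 = (G : ℤ) - t * r := by simp [hs1, h15]
  have v1 : s1 1 = r := by simp [hs1, h1]
  have hsub : ArithOp.sub.eval (s1 15) (s1 1) = (G : ℤ) - (t + 1 : ℕ) * r := by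
    simp only [ArithOp.eval, v15, v1]; push_cast; ring
  have hle : (G : ℤ) - (t + 1 : ℕ) * r ≤ W := by
    have : (0 : ℤ) ≤ (t + 1 : ℕ) * r := by positivity
    omega
  have e2 := Prog.Bounded.op (W := W) .sub 15 15 1 s1 (by omega) (by omega) (by simp)
    (by rw [hsub]; exact hle)
  rw [hsub] at e2
  have e3 := Prog.Bounded.const (W := W) 16 0
    (Function.update s1 15 ((G : ℤ) - (t + 1 : ℕ) * r)) (by omega)
  set s3 := Function.update (Function.update s1 15 ((G : ℤ) - (t + 1 : ℕ) * r)) 16 0 with hs3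
  have w15 : s3 15 = (G : ℤ) - (t + 1 : ℕ) * r := by simp [hs3]
  have w14 : s3 14 = (2 ^ (t + 1) : ℕ) := by simp [hs3, hs1]
  have w16 : s3 16 = 0 := by simp [hs3]
  have w11 : s3 11 = k := by simp [hs3, hs1, h11]
  have w3 : s3 3 = 1 := by simp [hs3, hs1, h3]
  have wi : ∀ i, i < 14 ∨ 18 ≤ i → s3 i = s i := fun i hi => by
    simp [hs3, hs1, show i ≠ 14 by omega, show i ≠ 15 by omega, show i ≠ 16 by omega]
  rcases Nat.lt_or_ge ((t + 1) * r) G with hlt | hge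
  · have hpos : 0 < s3 15 := by
      have : (((t + 1) * r : ℕ) : ℤ) < G := by exact_mod_cast hlt
      rw [w15]; push_cast at this ⊢; linarith
    have e4 := Prog.Bounded.op (W := W) .add 16 11 3 s3 (by omega) (by omega) (by simp)
      (by simp only [ArithOp.eval]; omega)
    rw [show ArithOp.add.eval (s3 11) (s3 3) = (k + 1 : ℕ) by simp [ArithOp.eval, w11, w3]] at e4
    set s4 := Function.update s3 16 ((k + 1 : ℕ) : ℤ) with hs4
    have u16 : s4 16 = (k + 1 : ℕ) := by simp [hs4]
    have u14 : s4 14 = (2 ^ (t + 1) : ℕ) := by simp [hs4, w14]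
    have e5 := Prog.Bounded.op (W := W) .sub 16 16 14 s4 (by omega) (by omega) (by simp)
      (by simp only [ArithOp.eval]; omega)
    refine ⟨_, _, (e1.seq e2).seq (e3.seq (.ite_pos hpos (e4.seq e5))), by omega, ?_, ?_, ?_,
      fun i hi => ?_⟩
    · simpa using u14
    · simp [hs4, w15]
    · simp only [Function.update_self, ArithOp.eval, u16, u14, hlt, true_and]; omega
    · simp [hs4, show i ≠ 16 by omega, wi i hi]
  · have hneg : s3 15 ≤ 0 := by
      have : (G : ℤ) ≤ ((t + 1) * r : ℕ) := by exact_mod_cast hge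
      rw [w15]; push_cast at this ⊢; linarith
    have e4 := Prog.Bounded.const (W := W) 17 0 s3 (by omega)
    refine ⟨_, _, (e1.seq e2).seq (e3.seq (.ite_neg hneg e4)), by omega, ?_, ?_, ?_,
      fun i hi => ?_⟩
    · simpa using w14
    · simpa using w15
    · simp [w16]; omega
    · simp [show i ≠ 17 by omega, wi i hi]

/-- The loop stops at the first `T` with `T r ≥ G` or `2 ^ T > k`; since `k < 2 ^ (t + m)`, at most
`m` rounds remain. -/
lemma bounded_growLoop {W r G k : ℕ} (hG : G ≤ W) (hk : 2 * k ≤ W) (m : ℕ) :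
    ∀ (t : ℕ) (s : ℕ → ℤ), k < 2 ^ (t + m) → s 1 = r → s 3 = 1 → s 11 = k →
      s 14 = (2 ^ t : ℕ) → s 15 = (G : ℤ) - t * r → 0 < s 16 → t * r < G → 2 ^ t ≤ k →
    ∃ s' n T, (Prog.loop 16 growStep).Bounded W s s' n ∧ n ≤ m * 7 + 1 ∧ T ≤ t + m ∧
      s' 15 = (G : ℤ) - T * r ∧ (T * r < G → k < 2 ^ T) ∧
      ∀ i, i < 14 ∨ 18 ≤ i → s' i = s i := by
  induction m with
  | zero => intro t s hkt _ _ _ _ _ _ _ htk; rw [add_zero] at hkt; omega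
  | succ m ih =>
    intro t s hkt h1 h3 h11 h14 h15 h16 htG htk
    obtain ⟨s1, n1, e1, hn1, r14, r15, r16, ri⟩ :=
      bounded_growStep h1 h3 h11 h14 h15 htG htk hG hk
    by_cases hc : (t + 1) * r < G ∧ 2 ^ (t + 1) ≤ k
    · obtain ⟨s2, n2, T, e2, hn2, hT, q15, qT, qi⟩ := ih (t + 1) s1
        (by rwa [show t + 1 + m = t + (m + 1) by ring]) (by rw [ri 1 (by norm_num), h1])
        (by rw [ri 3 (by norm_num), h3]) (by rw [ri 11 (by norm_num), h11]) r14 r15 (r16.2 hc)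
        hc.1 hc.2
      exact ⟨s2, _, T, .loop_pos h16 e1 e2, by omega, by omega, q15, qT,
        fun i hi => by rw [qi i hi, ri i hi]⟩
    · refine ⟨s1, _, t + 1, .loop_pos h16 e1 (.loop_neg (not_lt.1 fun h => hc (r16.1 h))),
        by omega, by omega, r15, fun h => ?_, ri⟩
      by_contra hk'
      exact hc ⟨h, not_lt.1 hk'⟩

/-! ### Bounds on the values -/

lemma closedForm_le (x : BranchVar) (G : ℕ) :
    closedForm x G ≤ 1 + 2 * (cdiv G x.r * valueBound x.r G ^ cdiv G x.r) := by
  have hr : 0 < x.r := x.l_pos.trans x.l_le_r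
  rw [closedForm_eq_depth_sum]
  gcongr
  refine (Finset.sum_le_card_nsmul _ _ (valueBound x.r G ^ cdiv G x.r) fun k hk => ?_).trans
    (by simp)
  rw [Finset.mem_range] at hk
  have hkG : k * x.r < G := by
    by_contra h
    exact absurd ((cdiv_le_iff hr).2 (not_lt.1 h)) (by omega)
  have hk' : k ≤ k * x.r := Nat.le_mul_of_pos_right k hr
  calc levelCount x.l x.r G k ≤ (k + G) ^ (k + 1) := levelCount_le x.l_pos hkG
    _ ≤ valueBound x.r G ^ (k + 1) := Nat.pow_le_pow_left (by unfold valueBound; omega) _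
    _ ≤ valueBound x.r G ^ cdiv G x.r :=
      Nat.pow_le_pow_right (by unfold valueBound; omega) (by omega)

lemma valueBound_pow_le {r G d L : ℕ} (hr : r ≤ 2 ^ L) (hG : G ≤ 2 ^ L) (hd : d ≤ L) :
    valueBound r G ^ d ≤ 2 ^ ((L + 2) * L) := by
  have : valueBound r G ≤ 2 ^ (L + 2) := by
    rw [valueBound, pow_add]; omega
  calc valueBound r G ^ d ≤ (2 ^ (L + 2)) ^ d := Nat.pow_le_pow_left this d
    _ ≤ (2 ^ (L + 2)) ^ L := Nat.pow_le_pow_right (by positivity) hd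
    _ = 2 ^ ((L + 2) * L) := (pow_mul _ _ _).symm

/-- The exponent `(L + 2)²` absorbs `(L + 2) L` for a summand, `L` for the number of summands and
`2` for the outer `1 + 2 ·`. -/
lemma closedForm_le_two_pow (x : BranchVar) {G L : ℕ} (hr : x.r ≤ 2 ^ L) (hG : G ≤ 2 ^ L)
    (hd : cdiv G x.r ≤ L) : closedForm x G ≤ 2 ^ (L + 2) ^ 2 := by
  have h1 := valueBound_pow_le hr hG hd
  have h2 : L < 2 ^ L := Nat.lt_two_pow_self
  have h3 : cdiv G x.r * valueBound x.r G ^ cdiv G x.r ≤ 2 ^ L * 2 ^ ((L + 2) * L) :=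
    Nat.mul_le_mul (by omega) h1
  rw [← pow_add] at h3
  have h4 : 2 ^ (L + (L + 2) * L + 2) ≤ 2 ^ (L + 2) ^ 2 :=
    Nat.pow_le_pow_right (by norm_num) (by nlinarith)
  rw [pow_add] at h4
  have h5 : 0 < 2 ^ (L + (L + 2) * L) := by positivity
  have := closedForm_le x G
  omega

lemma bounded_compareFormula (x : BranchVar) {G k W : ℕ} {s : ℕ → ℤ}
    (hW : valueBound x.r G ^ cdiv G x.r ≤ W) (hF : closedForm x G ≤ W) (hG : G ≤ W)
    (hk : k + 1 ≤ W) (h0 : s 0 = x.l) (h1 : s 1 = x.r) (h2 : s 2 = G) (h11 : s 11 = k)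
    (h13 : s 13 = 0) :
    ∃ s' n, compareFormula.Bounded W s s' n ∧ n ≤ cdiv G x.r * (6 * cdiv G x.r + 13) + 13 ∧
      s' 13 = if closedForm x G ≤ k then 1 else 0 := by
  obtain ⟨s1, n1, e1, hn1, r0, ri⟩ := bounded_formulaProg x hW hF hG h0 h1 h2
  -- Register `3` is not among those guaranteed to survive the evaluation, so the constant `1` is
  -- written again.
  have e2 := Prog.Bounded.const (W := W) 3 1 s1 (by omega)
  set s2 := Function.update s1 3 1 with hs2
  have e3 := bounded_leTest (W := W) (i := 0) (j := 11) (a := closedForm x G) (b := k) (s := s2)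
    (by norm_num) (by simp [hs2]) (by simp [hs2, r0]) (by simp [hs2, ri, h11]) hk
  set s3 := Function.update s2 17 ((k : ℤ) + 1 - closedForm x G) with hs3
  have v17 : s3 17 = (k : ℤ) + 1 - closedForm x G := by simp [hs3]
  have v13 : s3 13 = 0 := by simp [hs3, hs2, ri, h13]
  by_cases h : closedForm x G ≤ k
  · have e4 := Prog.Bounded.const (W := W) 13 1 s3 (by omega)
    exact ⟨_, _, (e1.seq e2).seq (e3.seq (.ite_pos (by omega) e4)), by omega, by simp [h]⟩
  · have e4 := Prog.Bounded.const (W := W) 17 0 s3 (by omega)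
    exact ⟨_, _, (e1.seq e2).seq (e3.seq (.ite_neg (by omega) e4)), by omega, by simp [h, v13]⟩

lemma two_pow_le_two_pow_sq {L j : ℕ} (hj : j ≤ 4 * L + 4) : 2 ^ j ≤ 2 ^ (L + 2) ^ 2 :=
  Nat.pow_le_pow_right (by norm_num) (by nlinarith)

/-- The lower bound on the tree size makes the algorithm polynomial: the formula is evaluated only
when `d ≤ L` is known, so no value has a superpolynomial number of bits. -/
lemma bounded_decideValid (x : BranchVar) {G k L : ℕ} {s : ℕ → ℤ} (hxG : x.r ≤ G)
    (hGL : G < 2 ^ L) (hk1 : 1 ≤ k) (hkL : k < 2 ^ L) (h0 : s 0 = x.l) (h1 : s 1 = x.r)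
    (h2 : s 2 = G) (h3 : s 3 = 1) (h11 : s 11 = k) (h13 : s 13 = 0) :
    ∃ s' n, decideValid.Bounded (2 ^ (L + 2) ^ 2) s s' n ∧ n ≤ L * (6 * L + 20) + 19 ∧
      s' 13 = if closedForm x G ≤ k then 1 else 0 := by
  set W := 2 ^ (L + 2) ^ 2 with hWdef
  have hWL : 2 ^ (L + 1) ≤ W := two_pow_le_two_pow_sq (by omega)
  rw [pow_succ] at hWL
  have hr : 0 < x.r := x.l_pos.trans x.l_le_r
  have e1 := Prog.Bounded.const (W := W) 14 1 s (by omega)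
  have e2 := Prog.Bounded.const (W := W) 15 0 (Function.update s 14 1) (by omega)
  set s2 := Function.update (Function.update s 14 1) 15 0 with hs2
  have hadd : ArithOp.add.eval (s2 15) (s2 2) = G := by simp [ArithOp.eval, hs2, h2]
  have e3 := Prog.Bounded.op (W := W) .add 15 15 2 s2 (by simp [hs2]) (by simp [hs2, h2])
    (by simp) (by rw [hadd]; omega)
  rw [hadd] at e3
  have e4 := Prog.Bounded.const (W := W) 16 1 (Function.update s2 15 G) (by omega)
  set s4 := Function.update (Function.update s2 15 (G : ℤ)) 16 1 with hs4
  have vi : ∀ i, i < 14 → s4 i = s i := fun i hi => by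
    simp [hs4, hs2, show i ≠ 14 by omega, show i ≠ 15 by omega, show i ≠ 16 by omega]
  obtain ⟨s5, n5, T, e5, hn5, hT, r15, rT, ri⟩ := bounded_growLoop (W := W) (r := x.r) (G := G)
    (k := k) (by omega) (by omega) L 0 s4 (by simpa using hkL) (by rw [vi 1 (by norm_num), h1])
    (by rw [vi 3 (by norm_num), h3]) (by rw [vi 11 (by norm_num), h11])
    (by simp [hs4, hs2]) (by simp [hs4]) (by simp [hs4]) (by omega) (by simpa using hk1)
  have wi : ∀ i, i < 14 → s5 i = s i := fun i hi => by rw [ri i (.inl hi), vi i hi]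
  rcases Nat.lt_or_ge (T * x.r) G with hlt | hge
  · have hpos : 0 < s5 15 := by
      have : ((T * x.r : ℕ) : ℤ) < G := by exact_mod_cast hlt
      rw [r15]; push_cast at this; linarith
    -- The chain is `k < 2 ^ T ≤ 2 ^ d ≤ 2 ^ (d + 1) - 1 ≤ t(G)`, where `T r < G` gives `T ≤ d`.
    have hno : ¬ closedForm x G ≤ k := by
      have hTd : T ≤ depth x G := by
        rw [depth_eq]
        by_contra h
        exact absurd ((cdiv_le_iff hr).1 (not_le.1 h).le) (by omega)
      have h4 : 2 ^ T ≤ 2 ^ depth x G := Nat.pow_le_pow_right (by norm_num) hTd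
      have h5 := two_pow_depth_le x G
      have h6 := rT hlt
      rw [pow_succ] at h5
      omega
    have e6 := Prog.Bounded.const (W := W) 17 0 s5 (by omega)
    exact ⟨_, _, ((e1.seq e2).seq (e3.seq e4)).seq (e5.seq (.ite_pos hpos e6)), by nlinarith,
      by simp [hno, wi, h13]⟩
  · have hneg : s5 15 ≤ 0 := by
      have : (G : ℤ) ≤ (T * x.r : ℕ) := by exact_mod_cast hge
      rw [r15]; push_cast at this; linarith
    have hd : cdiv G x.r ≤ L := ((cdiv_le_iff hr).2 hge).trans (by omega)
    obtain ⟨s6, n6, e6, hn6, r13⟩ := bounded_compareFormula x (W := W) (k := k) (s := s5)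
      ((valueBound_pow_le (by omega) (by omega) hd).trans
        (Nat.pow_le_pow_right (by norm_num) (by nlinarith)))
      (closedForm_le_two_pow x (by omega) (by omega) hd) (by omega) (by omega)
      (by rw [wi 0 (by norm_num), h0]) (by rw [wi 1 (by norm_num), h1])
      (by rw [wi 2 (by norm_num), h2]) (by rw [wi 11 (by norm_num), h11])
      (by rw [wi 13 (by norm_num), h13])
    refine ⟨_, _, ((e1.seq e2).seq (e3.seq e4)).seq (e5.seq (.ite_neg hneg e6)), ?_, r13⟩
    have : cdiv G x.r * (6 * cdiv G x.r + 13) ≤ L * (6 * L + 13) :=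
      Nat.mul_le_mul hd (by omega)
    nlinarith

/-- The numbers `l`, `r`, `G`, `k` form an instance whose answer is YES. -/
def IsYesInstance (l r G k : ℕ) : Prop :=
  ∃ x : BranchVar, x.l = l ∧ x.r = r ∧ r ≤ G ∧ 1 ≤ k ∧ closedForm x G ≤ k

theorem bounded_decideProg {l r G k L : ℕ} {s : ℕ → ℤ} (hr : r < 2 ^ L)
    (hG : G < 2 ^ L) (hk : k < 2 ^ L) (h0 : s 0 = l) (h1 : s 1 = r) (h2 : s 2 = G)
    (h11 : s 11 = k) :
    ∃ s' n, decideProg.Bounded (2 ^ (L + 2) ^ 2) s s' n ∧ n ≤ L * (6 * L + 20) + 30 ∧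
      (s' 13 = 0 ∨ s' 13 = 1) ∧ (s' 13 = 1 ↔ s 12 ≤ 0 ∧ IsYesInstance l r G k) := by
  set W := 2 ^ (L + 2) ^ 2 with hWdef
  have hWL : 2 ^ L ≤ W := two_pow_le_two_pow_sq (by omega)
  have e1 := Prog.Bounded.const (W := W) 13 0 s (by omega)
  have e2 := Prog.Bounded.const (W := W) 3 1 (Function.update s 13 0) (by omega)
  have e := e1.seq e2
  set s2 := Function.update (Function.update s 13 0) 3 1 with hs2
  have v13 : s2 13 = 0 := by simp [hs2]
  have v12 : s2 12 = s 12 := by simp [hs2]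
  have v0 : s2 0 = l := by simp [hs2, h0]
  have v1 : s2 1 = r := by simp [hs2, h1]
  have no : ∀ s' : ℕ → ℤ, (Prog.const 17 0).Bounded W s' (Function.update s' 17 0) 1 :=
    fun s' => .const 17 0 s' (by omega)
  rcases lt_or_ge 0 (s 12) with hbad | hbad
  · exact ⟨_, _, e.seq (.ite_pos (by rwa [v12]) (no _)), by omega, by simp [v13],
      by simp [v13, hbad]⟩
  rcases Nat.eq_zero_or_pos l with hl | hl
  · refine ⟨_, _, e.seq (.ite_neg (by rwa [v12]) (.ite_neg (by omega) (no _))), by omega,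
      by simp [v13], ?_⟩
    simp only [ne_eq, Nat.reduceEqDiff, not_false_eq_true, Function.update_of_ne, v13]
    refine iff_of_false (by norm_num) ?_
    rintro ⟨-, x, hx, -⟩
    have := x.l_pos
    omega
  have t1 := bounded_leTest (W := W) (i := 0) (j := 1) (a := l) (b := r) (s := s2) (by norm_num)
    (by simp [hs2]) v0 v1 (by omega)
  set s3 := Function.update s2 17 ((r : ℤ) + 1 - l) with hs3
  have u17 : s3 17 = (r : ℤ) + 1 - l := by simp [hs3]
  have u13 : s3 13 = 0 := by simp [hs3, v13]
  rcases Nat.lt_or_ge r l with hlr | hlr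
  · refine ⟨_, _, e.seq (.ite_neg (by rwa [v12]) (.ite_pos (by omega) (t1.seq
      (.ite_neg (by omega) (no _))))), by omega, by simp [u13], ?_⟩
    simp only [ne_eq, Nat.reduceEqDiff, not_false_eq_true, Function.update_of_ne, u13]
    refine iff_of_false (by norm_num) ?_
    rintro ⟨-, x, hx, hx', -⟩
    have := x.l_le_r
    omega
  have t2 := bounded_leTest (W := W) (i := 1) (j := 2) (a := r) (b := G) (s := s3) (by norm_num)
    (by simp [hs3, hs2]) (by simp [hs3, v1]) (by simp [hs3, hs2, h2]) (by omega)
  set s4 := Function.update s3 17 ((G : ℤ) + 1 - r) with hs4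
  have w17 : s4 17 = (G : ℤ) + 1 - r := by simp [hs4]
  have w13 : s4 13 = 0 := by simp [hs4, u13]
  have w11 : s4 11 = k := by simp [hs4, hs3, hs2, h11]
  rcases Nat.lt_or_ge G r with hrG | hrG
  · refine ⟨_, _, e.seq (.ite_neg (by rwa [v12]) (.ite_pos (by omega) (t1.seq
      (.ite_pos (by omega) (t2.seq (.ite_neg (by omega) (no _))))))), by omega,
      by simp [w13], ?_⟩
    simp only [ne_eq, Nat.reduceEqDiff, not_false_eq_true, Function.update_of_ne, w13]
    refine iff_of_false (by norm_num) ?_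
    rintro ⟨-, x, -, -, hx, -⟩
    omega
  rcases Nat.eq_zero_or_pos k with hk0 | hk0
  · refine ⟨_, _, e.seq (.ite_neg (by rwa [v12]) (.ite_pos (by omega) (t1.seq
      (.ite_pos (by omega) (t2.seq (.ite_pos (by omega) (.ite_neg (by omega) (no _)))))))),
      by omega, by simp [w13], ?_⟩
    simp only [ne_eq, Nat.reduceEqDiff, not_false_eq_true, Function.update_of_ne, w13]
    refine iff_of_false (by norm_num) ?_
    rintro ⟨-, x, -, -, -, hx, -⟩
    omega
  obtain ⟨s5, n5, e5, hn5, r13⟩ := bounded_decideValid ⟨l, r, hl, hlr⟩ (s := s4) hrG hG hk0 hk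
    (by simp [hs4, hs3, v0]) (by simp [hs4, hs3, v1]) (by simp [hs4, hs3, hs2, h2])
    (by simp [hs4, hs3, hs2]) w11 w13
  refine ⟨_, _, e.seq (.ite_neg (by rwa [v12]) (.ite_pos (by omega) (t1.seq
      (.ite_pos (by omega) (t2.seq (.ite_pos (by omega) (.ite_pos (by omega) e5))))))),
      by omega, by rw [r13]; split <;> simp, ?_⟩
  rw [r13]
  constructor
  · intro h
    refine ⟨hbad, ⟨l, r, hl, hlr⟩, rfl, rfl, hrG, hk0, ?_⟩
    by_contra hc
    simp [hc] at h
  · rintro ⟨-, ⟨l', r', hl', hlr'⟩, rfl, rfl, -, -, hle⟩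
    simp [hle]

/-! ### Parsing -/

/-- Split off the bits before the first separator; the second component tells whether there is a
separator, the third one is the word after it. -/
def chunk : List (Option Bool) → List Bool × Bool × List (Option Bool)
  | [] => ([], false, [])
  | none :: w => ([], true, w)
  | some b :: w => (b :: (chunk w).1, (chunk w).2)

lemma chunk_append (A : List Bool) (w : List (Option Bool)) :
    chunk (A.map some ++ none :: w) = (A, true, w) := by
  induction A with
  | nil => simp [chunk]
  | cons b A ih => simp [chunk, ih]

lemma chunk_map (A : List Bool) : chunk (A.map some) = (A, false, []) := by
  induction A with
  | nil => simp [chunk]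
  | cons b A ih => simp [chunk, ih]

lemma eq_of_chunk (w : List (Option Bool)) :
    w = (chunk w).1.map some ++ if (chunk w).2.1 then none :: (chunk w).2.2 else [] := by
  fun_induction chunk w with
  | case1 => rfl
  | case2 w => rfl
  | case3 b w ih => simpa using ih

lemma length_chunk (w : List (Option Bool)) :
    (chunk w).1.length + (chunk w).2.2.length ≤ w.length := by
  fun_induction chunk w <;> simp_all; omega

/-- Whether the last bit (`!c` if there is none) is zero. -/
def trailingZero (c : Bool) (A : List Bool) : Bool := A.foldl (fun _ b => !b) c

/-- The least significant bit comes first, so a nonempty numeral is canonical exactly when its last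
bit is one. The start value `c` matters only for the empty word. -/
lemma trailingZero_eq_false_iff (A : List Bool) : ∀ c, trailingZero c A = false ↔
    if A = [] then c = false else (bitsVal A).bits = A := by
  induction A with
  | nil => intro c; simp [trailingZero]
  | cons b A ih =>
    intro c
    have : trailingZero c (b :: A) = trailingZero (!b) A := rfl
    rw [this, ih, if_neg (List.cons_ne_nil b A), bitsVal_cons]
    rcases eq_or_ne A [] with rfl | hA
    · cases b <;> simp
    · rw [if_neg hA, show b.toNat + 2 * bitsVal A = Nat.bit b (bitsVal A) by
        rw [Nat.bit_val, add_comm]]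
      rcases Nat.eq_zero_or_pos (bitsVal A) with h0 | h0
      · rw [h0, Nat.zero_bits]
        refine iff_of_false (fun h => hA h.symm) fun h => ?_
        cases b <;> simp_all
      · rw [Nat.bits_append_bit _ _ fun h => absurd h h0.ne']
        simp

lemma trailingZero_iff (A : List Bool) : trailingZero false A = false ↔ (bitsVal A).bits = A := by
  rw [trailingZero_eq_false_iff]
  rcases eq_or_ne A [] with rfl | hA <;> simp_all

lemma trailingZero_bits (n : ℕ) : trailingZero false n.bits = false := by
  rw [trailingZero_iff, bitsVal_bits]

lemma encodePosNum_eq (p : PosNum) : Computability.encodePosNum p = (p : ℕ).bits := by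
  induction p with
  | one => simp [Computability.encodePosNum]
  | bit0 p ih =>
    rw [Computability.encodePosNum, ih, PosNum.cast_bit0, ← two_mul,
      Nat.bit0_bits _ (PosNum.cast_pos (α := ℕ) p).ne']
  | bit1 p ih =>
    rw [Computability.encodePosNum, ih, PosNum.cast_bit1, ← two_mul, Nat.bit1_bits]

/-- This identifies the input encoding with the numerals kept in the registers. -/
lemma bits_eq_map (n : ℕ) : bits n = n.bits.map some := by
  rw [bits]
  congr 1
  rw [Computability.encodeNat]
  rcases h : (n : Num) with - | p
  · have : ((n : Num) : ℕ) = 0 := by rw [h]; rfl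
    rw [Num.to_of_nat] at this
    simp [this, Computability.encodeNum]
  · have : ((n : Num) : ℕ) = p := by rw [h]; rfl
    rw [Num.to_of_nat] at this
    rw [Computability.encodeNum, encodePosNum_eq, this]

/-- The next number is not in canonical form, or (for the last number) it is followed by a
separator, or (for the other ones) it is not. -/
def malformed (last : Bool) (w : List (Option Bool)) : Bool :=
  trailingZero false (chunk w).1 || ((chunk w).2.1 == last)

lemma malformed_append (n : ℕ) (w : List (Option Bool)) :
    malformed false (bits n ++ none :: w) = false := by
  rw [malformed, bits_eq_map, chunk_append]
  simp [trailingZero_bits]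

lemma malformed_bits (n : ℕ) : malformed true (bits n) = false := by
  rw [malformed, bits_eq_map, chunk_map]
  simp [trailingZero_bits]

lemma eq_of_not_malformed {w : List (Option Bool)} (h : malformed false w = false) :
    w = bits (bitsVal (chunk w).1) ++ none :: (chunk w).2.2 := by
  simp only [malformed, Bool.or_eq_false_iff, beq_eq_false_iff_ne, ne_eq,
    Bool.not_eq_false] at h
  have := eq_of_chunk w
  rwa [if_pos h.2, ← (trailingZero_iff _).1 h.1, ← bits_eq_map] at this

lemma eq_of_not_malformed_last {w : List (Option Bool)} (h : malformed true w = false) :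
    w = bits (bitsVal (chunk w).1) := by
  simp only [malformed, Bool.or_eq_false_iff, beq_eq_false_iff_ne, ne_eq,
    Bool.not_eq_true] at h
  have := eq_of_chunk w
  rwa [h.2, if_neg Bool.false_ne_true, List.append_nil, ← (trailingZero_iff _).1 h.1,
    ← bits_eq_map] at this

/-- The word left after reading `i` numbers. -/
def rest (w : List (Option Bool)) (i : ℕ) : List (Option Bool) :=
  (fun v => (chunk v).2.2)^[i] w

/-- The `i`-th number read. -/
def number (w : List (Option Bool)) (i : ℕ) : ℕ := bitsVal (chunk (rest w i)).1

lemma rest_succ (w : List (Option Bool)) (i : ℕ) : rest w (i + 1) = (chunk (rest w i)).2.2 :=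
  Function.iterate_succ_apply' _ _ _

lemma length_rest_le (w : List (Option Bool)) (i : ℕ) : (rest w i).length ≤ w.length := by
  induction i with
  | zero => exact le_rfl
  | succ i ih =>
    have := length_chunk (rest w i)
    rw [rest_succ]; omega

lemma length_number_le (w : List (Option Bool)) (i : ℕ) :
    (chunk (rest w i)).1.length ≤ w.length := by
  have := length_chunk (rest w i)
  have := length_rest_le w i
  omega

lemma number_lt (w : List (Option Bool)) (i : ℕ) : number w i < 2 ^ w.length :=
  (bitsVal_lt _).trans_le (Nat.pow_le_pow_right (by norm_num) (length_number_le w i))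

/-- The `i`-th of four numbers is malformed. -/
def malformedAt (w : List (Option Bool)) (i : ℕ) : Bool := malformed (i == 3) (rest w i)

/-- A word that passes the four checks is the encoding of the four numbers read from it, because
noncanonical numerals and misplaced separators are rejected. Membership thus becomes a numerical
condition. -/
lemma mem_svbLanguage_iff (w : List (Option Bool)) : w ∈ svbLanguage ↔
    (∀ i < 4, malformedAt w i = false) ∧
      IsYesInstance (number w 0) (number w 1) (number w 2) (number w 3) := by
  constructor
  · rintro ⟨x, G, k, hxG, hk, hyes, rfl⟩
    set w := encodeInstance x.l x.r G k with hw
    have hw0 : rest w 0 = bits x.l ++ none :: (bits x.r ++ none :: (bits G ++ none :: bits k)) := by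
      simp [rest, hw, encodeInstance]
    have hw1 : rest w 1 = bits x.r ++ none :: (bits G ++ none :: bits k) := by
      rw [rest_succ, hw0, bits_eq_map x.l, chunk_append]
    have hw2 : rest w 2 = bits G ++ none :: bits k := by
      rw [rest_succ, hw1, bits_eq_map x.r, chunk_append]
    have hw3 : rest w 3 = bits k := by
      rw [rest_succ, hw2, bits_eq_map G, chunk_append]
    refine ⟨fun i hi => ?_, x, ?_, ?_, ?_, ?_, ?_⟩
    · unfold malformedAt
      interval_cases i
      · rw [hw0]; exact malformed_append _ _
      · rw [hw1]; exact malformed_append _ _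
      · rw [hw2]; exact malformed_append _ _
      · rw [hw3]; exact malformed_bits _
    · rw [number, hw0, bits_eq_map x.l, chunk_append, bitsVal_bits]
    · rw [number, hw1, bits_eq_map x.r, chunk_append, bitsVal_bits]
    · rwa [number, number, hw1, hw2, bits_eq_map x.r, bits_eq_map G, chunk_append, chunk_append,
        bitsVal_bits, bitsVal_bits]
    · rwa [number, hw3, bits_eq_map k, chunk_map, bitsVal_bits]
    · rw [number, number, hw2, hw3, bits_eq_map G, bits_eq_map k, chunk_append, chunk_map,
        bitsVal_bits, bitsVal_bits]
      exact (svbYes_iff x G k).1 hyes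
  · rintro ⟨hm, x, hl, hr, hG, hk, hle⟩
    refine ⟨x, number w 2, number w 3, hr ▸ hG, hk, (svbYes_iff _ _ _).2 hle, ?_⟩
    have h0 := eq_of_not_malformed (hm 0 (by norm_num))
    have h1 := eq_of_not_malformed (hm 1 (by norm_num))
    have h2 := eq_of_not_malformed (hm 2 (by norm_num))
    have h3 := eq_of_not_malformed_last (hm 3 (by norm_num))
    rw [← rest_succ] at h0 h1 h2
    change rest w 0 = bits (number w 0) ++ none :: rest w 1 at h0
    change rest w 1 = bits (number w 1) ++ none :: rest w 2 at h1
    change rest w 2 = bits (number w 2) ++ none :: rest w 3 at h2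
    change rest w 3 = bits (number w 3) at h3
    rw [h3] at h2
    rw [h2] at h1
    rw [h1] at h0
    change w = _ at h0
    rw [encodeInstance, hl, hr, List.append_assoc, List.append_assoc]
    exact h0

/-! ### Reading the input -/

section

variable {N : ℕ} {Λ : Type}

/-- Move the bits before the next separator to `t1`; push a bit to register `bad` if the number is
malformed. -/
def scanStmt (last : Bool) (bad : Fin N) (self next : Λ) : MStmt N Λ :=
  pop .inp (fun v a => (a.join, a.map fun _ => false, v.2.2)) <|
    branch (fun v => v.1.isSome)
      (push .t1 (fun v => v.1.getD false) <| load (fun v => (none, none, !v.1.getD false)) <|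
        goto fun _ => self) <|
      branch (fun v => v.2.2 || (v.2.1.isSome == last))
        (push (.reg bad) (fun _ => true) <| load (fun _ => Vars.init) <| goto fun _ => next)
        (load (fun _ => Vars.init) <| goto fun _ => next)

/-- Empty the input stack. -/
def drainStmt (self next : Λ) : MStmt N Λ :=
  pop .inp (fun _ a => (a.join, a.map fun _ => false, false)) <|
    branch (fun v => v.2.1.isSome) (goto fun _ => self) <|
      load (fun _ => Vars.init) <| goto fun _ => next

/-- Output whether register `i` is positive, and halt. -/
def answerStmt (i : Fin N) : MStmt N Λ :=
  pop (.reg i) (fun _ a => (a, none, false)) <| push .out (fun v => v.1.isSome) <|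
    load (fun _ => Vars.init) halt

variable {M : Λ → MStmt N Λ} {self next : Λ} {o t u : List Bool} {R : Fin N → List Bool}

/-- A separator and the end of the input both yield no bit; the second symbol of the internal state
tells them apart. The flag records whether the latest bit was zero. -/
lemma run_scanStmt {last : Bool} {bad : Fin N} (hM : M self = scanStmt last bad self next)
    (w : List (Option Bool)) : ∀ (t : List Bool) (a b : Option Bool) (c : Bool),
    Run M ((chunk w).1.length + 1) ⟨some self, (a, b, c), stks w o t u R⟩
      ⟨some next, Vars.init, stks (chunk w).2.2 o ((chunk w).1.reverse ++ t) u
        (if (trailingZero c (chunk w).1 || ((chunk w).2.1 == last)) = true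
          then Function.update R bad (true :: R bad) else R)⟩ := by
  induction w with
  | nil =>
    intro t a b c
    refine Run.single ?_
    cases c <;> cases last <;> simp [hM, scanStmt, chunk, trailingZero]
  | cons d w ih =>
    intro t a b c
    cases d with
    | none =>
      refine Run.single ?_
      cases c <;> cases last <;> simp [hM, scanStmt, chunk, trailingZero]
    | some d =>
      refine Run.head ?_
      simpa [hM, scanStmt, chunk, trailingZero] using ih (d :: t) none none (!d)

lemma run_drainStmt (hM : M self = drainStmt self next) (w : List (Option Bool)) : ∀ v : Vars,
    Run M (w.length + 1) ⟨some self, v, stks w o t u R⟩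
      ⟨some next, Vars.init, stks [] o t u R⟩ := by
  induction w with
  | nil =>
    intro v
    refine Run.single ?_
    simp [hM, drainStmt]
  | cons d w ih =>
    intro v
    refine Run.head ?_
    simpa [hM, drainStmt] using ih _

lemma run_answerStmt {i : Fin N} (hM : M self = answerStmt i) (v : Vars)
    {w : List (Option Bool)} :
    Run M 1 ⟨some self, v, stks w o t u R⟩
      ⟨none, Vars.init, stks w ((R i).head?.isSome :: o) t u
        (Function.update R i (R i).tail)⟩ := by
  refine Run.single ?_
  simp [hM, answerStmt]

variable [NeZero N]

/-- The registers after a number has been read into register `i`. -/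
def readReg (i bad : ℕ) (last : Bool) (w : List (Option Bool)) (s : ℕ → ℕ) : ℕ → ℕ :=
  Function.update (Function.update s bad
    (if malformed last w = true then 2 * s bad + 1 else s bad)) i (bitsVal (chunk w).1)

lemma run_read {last : Bool} {i bad : ℕ} (hi : i < N) (hbad : bad < N) (hne : i ≠ bad)
    {l₀ l₁ l₂ : Λ} (h₀ : M l₀ = scanStmt last (Fin.ofNat N bad) l₀ l₁)
    (h₁ : M l₁ = unwindStmt false (Fin.ofNat N i) l₁ l₂) (w : List (Option Bool)) {s : ℕ → ℕ}
    (hs : s i = 0) (a b : Option Bool) : ∃ b' : Option Bool,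
    Run M (2 * (w.length + 1)) ⟨some l₀, (a, b, false), stks w o [] [] (regs N s)⟩
      ⟨some l₂, (none, b', false),
        stks (chunk w).2.2 o [] [] (regs N (readReg i bad last w s))⟩ := by
  set s₁ := Function.update s bad (if malformed last w = true then 2 * s bad + 1 else s bad)
    with hs₁
  have r0 := run_scanStmt (o := o) (u := []) (R := regs N s) h₀ w [] a b false
  -- Pushing a one turns the numeral of `s bad` into that of `2 * s bad + 1`, so a recorded error is
  -- never lost.
  have hbits : (if (trailingZero false (chunk w).1 || ((chunk w).2.1 == last)) = true
      then Function.update (regs N s) (Fin.ofNat N bad) (true :: regs N s (Fin.ofNat N bad))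
      else regs N s) = regs N s₁ := by
    rw [hs₁, malformed]
    split
    · rw [regs_ofNat s hbad, ← Nat.bit1_bits, update_regs s hbad]
    · rw [Function.update_eq_self]
  rw [hbits, List.append_nil] at r0
  obtain ⟨b', r1⟩ := run_unwindStmt (w := (chunk w).2.2) (o := o) (u := []) (R := regs N s₁) h₁
    false (chunk w).1.reverse 0 none none
  have hs0 : s₁ i = 0 := by rw [hs₁, Function.update_of_ne hne, hs]
  rw [← hs0, ← regs_ofNat s₁ hi, Function.update_eq_self, hs0, List.foldl_reverse] at r1
  change Run M _ _ ⟨_, _, stks _ o [] [] (Function.update (regs N s₁) (Fin.ofNat N i)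
    (bitsVal (chunk w).1).bits)⟩ at r1
  rw [update_regs s₁ hi] at r1
  have := length_chunk w
  exact ⟨b', (r0.trans r1).mono (by rw [List.length_reverse]; omega)⟩

end

/-! ### Clearing registers -/

/-- Set the listed registers and register `0` to zero. -/
def Cmd.clear : List ℕ → Cmd
  | [] => .set 0 0
  | i :: l => .seq (.set i 0) (Cmd.clear l)

/-- The prescribed halting configuration has all stacks but the output empty, hence this cleanup. -/
lemma Cmd.exec_clear (W : ℕ) (l : List ℕ) : ∀ s : ℕ → ℕ,
    (Cmd.clear l).Exec W s (fun i => if i = 0 ∨ i ∈ l then 0 else s i) (l.length + 1) := by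
  induction l with
  | nil =>
    intro s
    have := Cmd.Exec.set (W := W) 0 0 s (Nat.zero_le W)
    convert this using 1
    · rfl
    · funext i
      simp [Function.update_apply]
    · rfl
  | cons j l ih =>
    intro s
    have := (Cmd.Exec.set (W := W) j 0 s (Nat.zero_le W)).seq (ih _)
    rw [List.length_cons]
    convert this using 1
    · rfl
    · funext i
      simp only [List.mem_cons, Function.update_apply]
      split_ifs <;> simp_all
    · omega

/-! ### The machine -/

/-- The command run after reading the input: decide and clean up. -/
def mainCmd : Cmd := .seq decideProg.cmd (Cmd.clear ((List.range 26).erase 21))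

/-- The labels of the machine. -/
inductive MLab : Type
  | scan (i : Fin 4)
  | unwind (i : Fin 4)
  | start
  | body (l : mainCmd.Lab)
  | drain
  | answer

/-- There are finitely many labels. -/
noncomputable instance : Fintype MLab :=
  letI := mainCmd.labFintype
  letI := Classical.decEq MLab
  Fintype.ofSurjective
    (fun x : (Fin 4 ⊕ Fin 4) ⊕ mainCmd.Lab ⊕ Fin 3 => match x with
      | .inl (.inl i) => MLab.scan i
      | .inl (.inr i) => MLab.unwind i
      | .inr (.inl l) => MLab.body l
      | .inr (.inr 0) => MLab.start
      | .inr (.inr 1) => MLab.drain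
      | .inr (.inr 2) => MLab.answer) fun y => by
    cases y with
    | scan i => exact ⟨.inl (.inl i), rfl⟩
    | unwind i => exact ⟨.inl (.inr i), rfl⟩
    | start => exact ⟨.inr (.inr 0), rfl⟩
    | body l => exact ⟨.inr (.inl l), rfl⟩
    | drain => exact ⟨.inr (.inr 1), rfl⟩
    | answer => exact ⟨.inr (.inr 2), rfl⟩

/-- The register receiving the `i`-th number. -/
def target : Fin 4 → ℕ
  | 0 => 8
  | 1 => 9
  | 2 => 10
  | 3 => 19

/-- The label after the `i`-th number has been read. -/
def afterRead : Fin 4 → MLab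
  | 0 => .scan 1
  | 1 => .scan 2
  | 2 => .scan 3
  | 3 => .start

/-- The statements of the machine. -/
def machine : MLab → MStmt 26 MLab
  | .scan i => scanStmt (i == 3) (Fin.ofNat 26 20) (.scan i) (.unwind i)
  | .unwind i => unwindStmt false (Fin.ofNat 26 (target i)) (.unwind i) (afterRead i)
  | .start => load (fun _ => Vars.init) <| goto fun _ => .body mainCmd.entry
  | .body l => mainCmd.code MLab.body .drain l
  | .drain => drainStmt .drain .answer
  | .answer => answerStmt (Fin.ofNat 26 21)

/-- The bundled machine. -/
noncomputable def tm : Turing.FinTM2 where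
  K := Stk 26
  k₀ := .inp
  k₁ := .out
  Γ := Alph 26
  Λ := MLab
  main := .scan 0
  σ := Vars
  initialState := Vars.init
  Γk₀Fin := inferInstanceAs (Fintype (Option Bool))
  m := machine

/-! ### Correctness and running time of the machine -/

lemma Cmd.clear_below {N : ℕ} (hN : 0 < N) (l : List ℕ) (h : ∀ i ∈ l, i < N) :
    (Cmd.clear l).Below N := by
  induction l with
  | nil => exact hN
  | cons i l ih => exact ⟨h i (by simp), ih fun j hj => h j (by simp [hj])⟩

/-- Registers `0` to `17` of the program become `8` to `25`; those below `8` are scratch space. In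
particular `19`, `20`, `21` are `k`, the malformed mark and the answer. -/
lemma mainCmd_below : mainCmd.Below 26 := by
  refine ⟨?_, Cmd.clear_below (by norm_num) _ (by decide)⟩
  simp [decideProg, leTest, decideValid, growStep, compareFormula, formulaProg, sumStep,
    chooseInit, ceilStep, chooseStep, Prog.cmd, ArithOp.cmd, Cmd.mulDiv, Cmd.reduceOnce,
    Cmd.scaleUp, Cmd.testGe, Cmd.testDouble, Cmd.double, Cmd.copy, Cmd.Below]

/-- The registers after `n` numbers have been read. -/
def readRegs (w : List (Option Bool)) : ℕ → ℕ → ℕ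
  | 0 => fun _ => 0
  | n + 1 => readReg (target (Fin.ofNat 4 n)) 20 (n == 3) (rest w n) (readRegs w n)

lemma readReg_apply {i bad : ℕ} (last : Bool) (w : List (Option Bool)) (s : ℕ → ℕ) (j : ℕ) :
    readReg i bad last w s j = if j = i then bitsVal (chunk w).1 else
      if j = bad then (if malformed last w = true then 2 * s bad + 1 else s bad) else s j := by
  simp only [readReg, Function.update_apply]

lemma readRegs_four (w : List (Option Bool)) :
    readRegs w 4 8 = number w 0 ∧ readRegs w 4 9 = number w 1 ∧ readRegs w 4 10 = number w 2 ∧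
      readRegs w 4 19 = number w 3 ∧
      (readRegs w 4 20 = 0 ↔ ∀ i < 4, malformedAt w i = false) ∧ readRegs w 4 20 ≤ 15 ∧
      ∀ i, i ≠ 8 → i ≠ 9 → i ≠ 10 → i ≠ 19 → i ≠ 20 → readRegs w 4 i = 0 := by
  refine ⟨?_, ?_, ?_, ?_, ?_, ?_, ?_⟩
  · simp [readRegs, readReg_apply, target, number]
  · simp [readRegs, readReg_apply, target, number]
  · simp [readRegs, readReg_apply, target, number]
  · simp [readRegs, readReg_apply, target, number]
  · have h : (∀ i < 4, malformedAt w i = false) ↔ malformedAt w 0 = false ∧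
        malformedAt w 1 = false ∧ malformedAt w 2 = false ∧ malformedAt w 3 = false :=
      ⟨fun h => ⟨h 0 (by norm_num), h 1 (by norm_num), h 2 (by norm_num), h 3 (by norm_num)⟩,
        fun h i hi => by interval_cases i <;> simp [h]⟩
    rw [h]
    simp only [malformedAt, readRegs, readReg_apply, target]
    simp
    cases malformed false (rest w 0) <;> cases malformed false (rest w 1) <;>
      cases malformed false (rest w 2) <;> cases malformed true (rest w 3) <;> simp
  · simp only [readRegs, readReg_apply, target]
    simp
    cases malformed false (rest w 0) <;> cases malformed false (rest w 1) <;>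
      cases malformed false (rest w 2) <;> cases malformed true (rest w 3) <;> simp
  · intro i h8 h9 h10 h19 h20
    simp [readRegs, readReg_apply, target, *]

lemma run_reads (w : List (Option Bool)) : ∃ b : Option Bool,
    Run machine (8 * (w.length + 1))
      ⟨some (.scan 0), Vars.init, stks w [] [] [] (regs 26 fun _ => 0)⟩
      ⟨some .start, (none, b, false), stks (rest w 4) [] [] [] (regs 26 (readRegs w 4))⟩ := by
  have step : ∀ (i : Fin 4) (b : Option Bool), readRegs w i (target i) = 0 → ∃ b' : Option Bool,
      Run machine (2 * (w.length + 1))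
        ⟨some (.scan i), (none, b, false), stks (rest w i) [] [] [] (regs 26 (readRegs w i))⟩
        ⟨some (afterRead i), (none, b', false),
          stks (rest w (i + 1)) [] [] [] (regs 26 (readRegs w (i + 1)))⟩ := by
    intro i b h
    obtain ⟨b', r⟩ := run_read (M := machine) (o := []) (l₀ := .scan i) (l₁ := .unwind i)
      (l₂ := afterRead i) (last := i == 3) (i := target i) (bad := 20)
      (by fin_cases i <;> decide) (by decide) (by fin_cases i <;> decide) rfl rfl (rest w i) h
      none b
    refine ⟨b', ?_⟩
    have hr : readRegs w (i + 1) = readReg (target i) 20 (i == 3) (rest w i) (readRegs w i) := by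
      fin_cases i <;> rfl
    rw [rest_succ, hr]
    exact r.mono (by have := length_rest_le w i; omega)
  obtain ⟨b1, r1⟩ := step 0 none (by simp [readRegs])
  obtain ⟨b2, r2⟩ := step 1 b1 (by simp [readRegs, readReg_apply, target])
  obtain ⟨b3, r3⟩ := step 2 b2 (by simp [readRegs, readReg_apply, target])
  obtain ⟨b4, r4⟩ := step 3 b3 (by simp [readRegs, readReg_apply, target])
  exact ⟨b4, (((r1.trans r2).trans r3).trans r4).mono (by omega)⟩

/-- A bound on the number of steps for the command run on an input of length `L`. -/
def mainCost (L : ℕ) : ℕ :=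
  ((L * (6 * L + 20) + 30) *
    (((L + 2) ^ 2 + 1) * (((L + 2) ^ 2 + 1) * 11 + 15) + 12) + 26) * (3 * ((L + 2) ^ 2 + 1) + 4)

lemma size_two_pow_add_one (m : ℕ) (hm : 0 < m) : (2 ^ m + 1).size ≤ m + 1 := by
  rw [Nat.size_le, pow_succ]
  have := Nat.one_lt_two_pow hm.ne'
  omega

/-- The time is a product: operations of the program, commands per operation, machine steps per
command. Clearing the registers adds `26` commands. -/
lemma run_mainCmd (w : List (Option Bool)) : ∃ c : ℕ, (c = 0 ∨ c = 1) ∧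
    (c = 1 ↔ w ∈ svbLanguage) ∧
    Run machine (mainCost w.length)
      ⟨some (.body mainCmd.entry), Vars.init,
        stks (rest w 4) [] [] [] (regs 26 (readRegs w 4))⟩
      ⟨some .drain, Vars.init,
        stks (rest w 4) [] [] [] (regs 26 (Function.update (fun _ => 0) 21 c))⟩ := by
  set L := w.length with hL
  set s : ℕ → ℕ := readRegs w 4 with hs
  obtain ⟨h8, h9, h10, h19, h20, h20', hi⟩ := readRegs_four w
  rw [← hs] at h8 h9 h10 h19 h20 h20' hi
  obtain ⟨s', n, e, hn, h13, hiff⟩ := bounded_decideProg (L := L)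
    (s := fun i => ((s (i + 8) : ℕ) : ℤ)) (number_lt w 1) (number_lt w 2) (number_lt w 3)
    (congrArg _ h8) (congrArg _ h9) (congrArg _ h10) (congrArg _ h19)
  set W := 2 ^ (L + 2) ^ 2 with hW
  have hWL : 2 ^ L ≤ W := two_pow_le_two_pow_sq (by omega)
  -- Needed for register `20`, which four error marks can raise to `15`.
  have hW4 : 2 ^ 4 ≤ W := two_pow_le_two_pow_sq (by omega)
  have hsW : ∀ i, s i ≤ W := by
    intro i
    have n0 := number_lt w 0
    have n1 := number_lt w 1
    have n2 := number_lt w 2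
    have n3 := number_lt w 3
    rw [← hL] at n0 n1 n2 n3
    by_cases c8 : i = 8
    · subst c8; omega
    by_cases c9 : i = 9
    · subst c9; omega
    by_cases c10 : i = 10
    · subst c10; omega
    by_cases c19 : i = 19
    · subst c19; omega
    by_cases c20 : i = 20
    · subst c20; omega
    have := hi i c8 c9 c10 c19 c20
    omega
  obtain ⟨S', e1, hS'⟩ := e.exec_cmd s (fun i => by exact_mod_cast hsW _) fun i => by simp
  have e2 := e1.seq (Cmd.exec_clear (W + 1) ((List.range 26).erase 21) S')
  have r := run_code (N := 26) (M := machine) (w := rest w 4) (o := []) e2 MLab.body .drain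
    (fun l => rfl) mainCmd_below fun i => (hsW i).trans (Nat.le_succ W)
  have hmem : w ∈ svbLanguage ↔ s' 13 = 1 := by
    rw [hiff, mem_svbLanguage_iff, ← h20]
    simp [hs]
  have h21 : S' 21 = (s' 13).toNat := hS' 13
  refine ⟨S' 21, by omega, by rw [hmem]; omega, ?_⟩
  have hregs : regs 26 (fun i => if i = 0 ∨ i ∈ (List.range 26).erase 21 then 0 else S' i) =
      regs 26 (Function.update (fun _ => 0) 21 (S' 21)) := by
    funext i
    rcases eq_or_ne (i : ℕ) 21 with h | h
    · rw [regs, regs, h, if_neg (by decide), Function.update_self]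
    · have : (i : ℕ) = 0 ∨ (i : ℕ) ∈ (List.range 26).erase 21 :=
        .inr ((List.mem_erase_of_ne h).2 (List.mem_range.2 i.2))
      rw [regs, regs, if_pos this, Function.update_of_ne h]
  rw [hregs] at r
  refine r.mono ?_
  have hz : (W + 1).size ≤ (L + 2) ^ 2 + 1 := size_two_pow_add_one _ (by positivity)
  rw [mainCost, opCost]
  gcongr
  decide

/-- A malformed word may leave symbols unread after four numbers; they are drained to reach the
halting configuration. -/
theorem run_machine (w : List (Option Bool)) (b : Bool) (hb : b = true ↔ w ∈ svbLanguage) :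
    Run machine (8 * (w.length + 1) + 1 + mainCost w.length + (w.length + 1) + 1)
      ⟨some (.scan 0), Vars.init, stks w [] [] [] (regs 26 fun _ => 0)⟩
      ⟨none, Vars.init, stks [] [b] [] [] fun _ => []⟩ := by
  obtain ⟨b₀, r1⟩ := run_reads w
  obtain ⟨c, hc, hcw, r3⟩ := run_mainCmd w
  have r2 : Run machine 1
      ⟨some .start, (none, b₀, false), stks (rest w 4) [] [] [] (regs 26 (readRegs w 4))⟩
      ⟨some (.body mainCmd.entry), Vars.init,
        stks (rest w 4) [] [] [] (regs 26 (readRegs w 4))⟩ := Run.single rfl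
  have r4 := run_drainStmt (M := machine) (self := .drain) (next := .answer) (o := []) (t := [])
    (u := []) (R := regs 26 (Function.update (fun _ => 0) 21 c)) rfl (rest w 4) Vars.init
  have r5 := run_answerStmt (M := machine) (self := .answer) (i := Fin.ofNat 26 21) (o := [])
    (t := []) (u := []) (w := []) (R := regs 26 (Function.update (fun _ => 0) 21 c)) rfl Vars.init
  have hlen := length_rest_le w 4
  have r := (((r1.trans r2).trans r3).trans r4).trans r5
  have hout : ((regs 26 (Function.update (fun _ => 0) 21 c) (Fin.ofNat 26 21)).head?.isSome) =
      b := by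
    rw [regs_ofNat _ (by norm_num), Function.update_self, Bool.eq_iff_iff, hb, ← hcw]
    rcases hc with rfl | rfl <;> simp
  have hregs : Function.update (regs 26 (Function.update (fun _ => 0) 21 c)) (Fin.ofNat 26 21)
      (regs 26 (Function.update (fun _ => 0) 21 c) (Fin.ofNat 26 21)).tail = fun _ => [] := by
    rw [regs_ofNat _ (by norm_num), Function.update_self,
      -- The answer has at most one bit, so reading it empties its register.
      show c.bits.tail = Nat.bits 0 by rcases hc with rfl | rfl <;> simp,
      update_regs _ (by norm_num), Function.update_idem]
    funext i
    simp [regs, Function.update_apply]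
  rw [hout, hregs] at r
  exact r.mono (by omega)

/-- A polynomial bounding the running time of the machine. -/
noncomputable def timePoly : Polynomial ℕ :=
  let L : Polynomial ℕ := Polynomial.X
  let Z : Polynomial ℕ := (L + 2) ^ 2 + 1
  8 * (L + 1) + 1 + ((L * (6 * L + 20) + 30) * (Z * (Z * 11 + 15) + 12) + 26) * (3 * Z + 4) +
    (L + 1) + 1

lemma timePoly_eval (L : ℕ) :
    timePoly.eval L = 8 * (L + 1) + 1 + mainCost L + (L + 1) + 1 := by
  simp [timePoly, mainCost]

lemma initList_tm (w : List (Option Bool)) : Turing.initList tm w =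
    (⟨some (.scan 0), Vars.init, stks w [] [] [] (regs 26 fun _ => 0)⟩ : MCfg 26 MLab) := by
  unfold Turing.initList
  congr 1
  funext k
  cases k
  case inp => rfl
  all_goals simp [tm, stks, regs]

lemma haltList_tm (b : Bool) : Turing.haltList tm [b] =
    (⟨none, Vars.init, stks [] [b] [] [] fun _ => []⟩ : MCfg 26 MLab) := by
  unfold Turing.haltList
  congr 1
  funext k
  cases k
  case out => rfl
  all_goals simp [tm, stks]

open Classical in
theorem inP_svbLanguage : InP svbLanguage := by
  refine ⟨⟨⟨tm, Equiv.refl _, Equiv.refl _⟩, timePoly, fun w => ?_⟩⟩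
  have r := run_machine w (decide (w ∈ svbLanguage)) (by simp)
  rw [← initList_tm, ← haltList_tm, ← timePoly_eval] at r
  change StateTransition.EvalsToInTime tm.step
    (Turing.initList tm (List.map id w : List (Option Bool)))
    (some (Turing.haltList tm (List.map id [decide (w ∈ svbLanguage)] : List Bool))) _
  rw [List.map_id, List.map_id]
  exact Classical.choice r

end BranchBound

/-! ### Operation count of the evaluation -/

open BranchBound in
lemma exists_formulaProg_cost : ∃ (p : Prog) (C : ℝ), ∀ (x : BranchVar) (G : ℕ), 1 ≤ G →
      ∃ (s : ℕ → ℤ) (n : ℕ),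
        Exec p (inputRegs x G) s n ∧
        s 0 = (closedForm x G : ℤ) ∧
        (n : ℝ) ≤ C * (depth x G : ℝ) ^ 2 ∧
        ∀ k : ℕ, 2 ^ (depth x G + 1) - 1 ≤ k → (n : ℝ) ≤ C * Real.log k ^ 2 := by
  -- For `d ≥ 1` one has `d (6 d + 13) + 8 ≤ 27 d²`, and `d ≤ 2 log k` because `2 ^ d ≤ k` and `log
  -- 2 > 1/2`; hence `108 = 27 · 2²`.
  refine ⟨formulaProg, 108, fun x G hG => ?_⟩
  have hr : 0 < x.r := x.l_pos.trans x.l_le_r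
  obtain ⟨s, n, e, hn, h0, -⟩ := bounded_formulaProg x (G := G)
    -- Only operations are counted here, so any sufficiently large bound on the values will do.
    (W := valueBound x.r G ^ cdiv G x.r + closedForm x G + G) (s := inputRegs x G)
    (by omega) (by omega) (by omega) rfl rfl rfl
  have hd : 0 < depth x G := by rw [depth_eq]; exact cdiv_pos hr hG
  rw [← depth_eq] at hn
  have hn27 : n ≤ 27 * depth x G ^ 2 := hn.trans (by nlinarith)
  have hn27' : (n : ℝ) ≤ 27 * (depth x G : ℝ) ^ 2 := by exact_mod_cast hn27
  refine ⟨s, n, e.exec, h0, hn27'.trans (by nlinarith [sq_nonneg (depth x G : ℝ)]),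
    fun k hk => ?_⟩
  have hk2 : 2 ^ depth x G ≤ k := by
    have := Nat.one_le_two_pow (n := depth x G)
    rw [pow_succ] at hk
    omega
  have hlog : (depth x G : ℝ) ≤ 2 * Real.log k := by
    have h1 : Real.log ((2 : ℝ) ^ depth x G) ≤ Real.log k :=
      Real.log_le_log (by positivity) (by exact_mod_cast hk2)
    rw [Real.log_pow] at h1
    have h2 := Real.log_two_gt_d9
    nlinarith [(Nat.cast_nonneg (depth x G) : (0 : ℝ) ≤ _)]
  calc (n : ℝ) ≤ 27 * (depth x G : ℝ) ^ 2 := hn27'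
    _ ≤ 27 * (2 * Real.log k) ^ 2 := by gcongr
    _ = 108 * Real.log k ^ 2 := by ring

theorem mainTheorem2 :
    -- the decision problem is in P
    BranchBound.InP BranchBound.svbLanguage ∧
    -- the minimal tree is well defined, and its size is given by the closed formula
    (∀ (x : BranchBound.BranchVar) (G : ℕ), 1 ≤ G →
      (∃! T : BranchBound.BBTree, T.IsMinimalFor x G) ∧
      ∀ T : BranchBound.BBTree, T.IsMinimalFor x G → T.size = BranchBound.closedForm x G) ∧
    -- if `k < 2 ^ (d + 1) - 1`, the answer is NO
    (∀ (x : BranchBound.BranchVar) (G k : ℕ), 1 ≤ G →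
      BranchBound.SVBYes x G k → 2 ^ (BranchBound.depth x G + 1) - 1 ≤ k) ∧
    -- otherwise the formula is evaluated in `O(d ^ 2) = O(log ^ 2 k)` arithmetic operations
    (∃ (p : BranchBound.Prog) (C : ℝ), ∀ (x : BranchBound.BranchVar) (G : ℕ), 1 ≤ G →
      ∃ (s : ℕ → ℤ) (n : ℕ),
        BranchBound.Exec p (BranchBound.inputRegs x G) s n ∧
        s 0 = (BranchBound.closedForm x G : ℤ) ∧
        (n : ℝ) ≤ C * (BranchBound.depth x G : ℝ) ^ 2 ∧
        ∀ k : ℕ, 2 ^ (BranchBound.depth x G + 1) - 1 ≤ k → (n : ℝ) ≤ C * Real.log k ^ 2) :=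
  ⟨BranchBound.inP_svbLanguage,
    fun x G _ => ⟨⟨BranchBound.minTree x G, BranchBound.minTree_isMinimalFor x G,
      fun _ hT => hT.eq_minTree⟩,
      fun _ hT => by rw [hT.eq_minTree, BranchBound.minTree_size]⟩,
    fun x G k _ h =>
      (BranchBound.two_pow_depth_le x G).trans ((BranchBound.svbYes_iff x G k).1 h),
    exists_formulaProg_cost⟩
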